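/- Let $Q=(q_{ij})_{i,j\ge 0}$ be a totally stable and conservative single death rate matrix on $E=\{0,1,2,\dots\}$ with $0$ absorbing: all entries are real, $q_{ij}\ge 0$ for $i\ne j$, $\sum_{j\ge 0} q_{ij}=0$ for every $i$, $q_{0j}=0$ for all $j\ge 0$, and for every $i\ge 1$, $q_{i,i-1}>0$ and $q_{ij}=0$ whenever $j\le i-2$. Let $Y=(Y_t)_{t\ge 0}$ be the minimal continuous-time Markov chain with rate matrix $Q$ (sent to a cemetery at its explosion time), let $\mathbb P_i$, $\mathbb E_i$ refer to the start $Y_0=i$, and let $T_a=\inf\{t\ge 0: Y_t=a\}$. Let $\omega=(\omega_i)_{i\ge 1}$ be a non-negative function. Put $$q_n^{(k)}(\omega)=\sum_{j=k}^\infty q_{nj}+\omega_n,\qquad G_n^{(n)}(\omega)=1\ (n\ge 1),\qquad G_n^{(k)}(\omega)=\sum_{l=n+1}^{k}\frac{q_n^{(l)}(\omega)\,G_l^{(k)}(\omega)}{q_{n,n-1}}\ (k>n\ge 1),$$ and for $i,j\ge 0$ (empty sums being $0$) $$W^{(\omega)}(i,j)=\sum_{k=i+1}^{j}\frac{G_k^{(j)}(\omega)}{q_{j,j-1}},\qquad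 Z^{(\omega)}(i,j)=\begin{cases}1+\sum_{i<u<j}\omega_u W^{(\omega)}(i,u), & i<j,\\ 0,& i\ge j,\end{cases}$$ and $W=W^{(0)}$. Assume that $\mathbb P_i[T_0<\infty]=1$ for every $i\ge 1$. Then for all integers $i>a\ge 0$, $$\mathbb E_i\Big[\exp\Big(-\int_0^{T_a}\omega(Y_t)\,dt\Big)\Big]=\lim_{N\to\infty}\frac{W^{(\omega)}(i,N)}{W^{(\omega)}(a,N)}=\lim_{N\to\infty}\frac{Z^{(\omega)}(i,N)}{Z^{(\omega)}(a,N)},$$ where both limits exist. If in addition $\sum_{u=1}^\infty \omega_u W(0,u)<\infty$, then for every $i\ge 0$ $$Z^{(\omega)}(i,\infty):=1+\sum_{u=i+1}^\infty \omega_u W^{(\omega)}(i,u)<\infty,$$ and for all integers $i>a\ge 0$ $$\mathbb E_i\Big[\exp\Big(-\int_0^{T_a}\omega(Y_t)\,dt\Big)\Big]=\frac{Z^{(\omega)}(i,\infty)}{Z^{(\omega)}(a,\infty)}.$$ -/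

import Mathlib

open MeasureTheory Filter Topology
open scoped ENNReal NNReal

noncomputable section

namespace SingleDeath

/-- Conservative, totally stable single death rate matrices on `{0, 1, 2, …}` for which `0` is
absorbing: all entries are real (total stability) and every row sums to `0` (conservativity). -/
structure IsSingleDeathRate (q : ℕ → ℕ → ℝ) : Prop where
  nonneg : ∀ i j, i ≠ j → 0 ≤ q i j
  zero_row : ∀ j, q 0 j = 0
  down_pos : ∀ i, 1 ≤ i → 0 < q i (i - 1)
  skip_free : ∀ i j, j + 2 ≤ i → q i j = 0
  conservative : ∀ i, HasSum (fun j => q i j) 0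

/-- The total exit rate `q_i = -q_{ii}`. -/
def exitRate (q : ℕ → ℕ → ℝ) (i : ℕ) : ℝ := -q i i

/-- Transition probabilities of the embedded jump chain; states with exit rate `0` are
absorbing. -/
def jumpProb (q : ℕ → ℕ → ℝ) (i j : ℕ) : ℝ :=
  if exitRate q i = 0 then (if i = j then 1 else 0)
  else (if i = j then 0 else q i j / exitRate q i)

/-- `J 0, J 1, …` are the successively visited states and `S 0, S 1, …` the holding times of the
minimal continuous-time Markov chain with rate matrix `q`, where `P i` is the law under which the
chain starts at `i`: the visited states form a Markov chain with transition matrix `jumpProb q`,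
and given the visited states, the holding times are independent and exponential with parameters
`exitRate q (J k)` (infinite if the parameter is `0`). -/
structure IsMinimalChain (q : ℕ → ℕ → ℝ) {Ω : Type*} [MeasurableSpace Ω]
    (P : ℕ → Measure Ω) (J : ℕ → Ω → ℕ) (S : ℕ → Ω → ℝ≥0∞) : Prop where
  prob : ∀ i, IsProbabilityMeasure (P i)
  measurable_state : ∀ n, Measurable (J n)
  measurable_hold : ∀ n, Measurable (S n)
  law : ∀ (i n : ℕ) (x : ℕ → ℕ) (t : ℕ → ℝ≥0),
    P i {w | ∀ k ≤ n, J k w = x k ∧ (t k : ℝ≥0∞) < S k w} =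
      ENNReal.ofReal ((if x 0 = i then 1 else 0) *
        (∏ k ∈ Finset.range n, jumpProb q (x k) (x (k + 1))) *
        ∏ k ∈ Finset.range (n + 1), Real.exp (-(exitRate q (x k) * t k)))

/-- The time of the `n`-th jump, for holding times `s`. -/
def jumpTime (s : ℕ → ℝ≥0∞) (n : ℕ) : ℝ≥0∞ := ∑ k ∈ Finset.range n, s k

open Classical in
/-- The state at time `t` of the path that visits `x 0, x 1, …` with holding times `s 0, s 1, …`;
from the explosion time on the path is in the cemetery `none`. -/
def path (x : ℕ → ℕ) (s : ℕ → ℝ≥0∞) (t : ℝ≥0) : Option ℕ :=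
  if h : ∃ n, jumpTime s n ≤ (t : ℝ≥0∞) ∧ (t : ℝ≥0∞) < jumpTime s (n + 1) then
    some (x (Nat.find h))
  else none

/-- The process `Y_t`. -/
def process {Ω : Type*} (J : ℕ → Ω → ℕ) (S : ℕ → Ω → ℝ≥0∞) (t : ℝ≥0) (w : Ω) : Option ℕ :=
  path (fun n => J n w) (fun n => S n w) t

/-- The first hitting time `inf {t ≥ 0 : Y_t = a}` of the state `a` (`inf ∅ = ∞`). -/
def hittingTime {Ω : Type*} (Y : ℝ≥0 → Ω → Option ℕ) (a : ℕ) (w : Ω) : ℝ≥0∞ :=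
  sInf ((fun t : ℝ≥0 => (t : ℝ≥0∞)) '' {t | Y t w = some a})

/-- A function on the states, extended by `0` to the cemetery. -/
def extend (ω : ℕ → ℝ) (y : Option ℕ) : ℝ := y.elim 0 ω

/-- The integral `∫_0^{T_a} ω(Y_t) dt`, with values in `[0, ∞]`. -/
def additive {Ω : Type*} (Y : ℝ≥0 → Ω → Option ℕ) (ω : ℕ → ℝ) (a : ℕ) (w : Ω) : ℝ≥0∞ :=
  ∫⁻ t in {t : ℝ | 0 ≤ t ∧ ENNReal.ofReal t < hittingTime Y a w},
    ENNReal.ofReal (extend ω (Y t.toNNReal w))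

/-- `x ↦ e^{-x}` on `[0, ∞]`, with `e^{-∞} = 0`. -/
def expNeg (x : ℝ≥0∞) : ℝ := if x = ⊤ then 0 else Real.exp (-x.toReal)

/-- `q_n^{(k)}(ω) = ∑_{j ≥ k} q_{nj} + ω_n`. -/
def tail (q : ℕ → ℕ → ℝ) (ω : ℕ → ℝ) (n k : ℕ) : ℝ := (∑' j, q n (k + j)) + ω n

/-- `G_n^{(k)}(ω)`, meant for `1 ≤ n ≤ k`. -/
def G (q : ℕ → ℕ → ℝ) (ω : ℕ → ℝ) (n k : ℕ) : ℝ :=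
  if n = k then 1
  else ∑ l ∈ (Finset.Ioc n k).attach, tail q ω n l.1 * G q ω l.1 k / q n (n - 1)
termination_by k - n
decreasing_by
  have := Finset.mem_Ioc.mp l.2
  omega

theorem G_self (q : ℕ → ℕ → ℝ) (ω : ℕ → ℝ) (n : ℕ) : G q ω n n = 1 := by
  rw [G, if_pos rfl]

theorem G_of_lt (q : ℕ → ℕ → ℝ) (ω : ℕ → ℝ) {n k : ℕ} (h : n < k) :
    G q ω n k = ∑ l ∈ Finset.Ioc n k, tail q ω n l * G q ω l k / q n (n - 1) := by
  rw [G, if_neg h.ne]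
  exact Finset.sum_attach (Finset.Ioc n k) (fun l => tail q ω n l * G q ω l k / q n (n - 1))

/-- The scale function `W^{(ω)}(i, j)`. -/
def W (q : ℕ → ℕ → ℝ) (ω : ℕ → ℝ) (i j : ℕ) : ℝ :=
  ∑ k ∈ Finset.Ioc i j, G q ω k j / q j (j - 1)

/-- The function `Z^{(ω)}(i, j)`. -/
def Z (q : ℕ → ℕ → ℝ) (ω : ℕ → ℝ) (i j : ℕ) : ℝ :=
  if i < j then 1 + ∑ u ∈ Finset.Ioo i j, ω u * W q ω i u else 0

/-- `Z^{(ω)}(i, ∞) = 1 + ∑_{u ≥ i + 1} ω_u W^{(ω)}(i, u)`, meant for a convergent series. -/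
def ZInf (q : ℕ → ℕ → ℝ) (ω : ℕ → ℝ) (i : ℕ) : ℝ :=
  1 + ∑' u, ω (i + 1 + u) * W q ω i (i + 1 + u)

end SingleDeath

end

noncomputable section

namespace SingleDeath

/-! Both sides are identified with one quantity of the jump chain. Given the visited states, the
holding times are independent exponentials, so integrating them out turns `exp(-∫ω)` into a factor
`q_y / (q_y + ω_y)` for each visit to a state `y > a`. The Laplace functional therefore equals
`hitSum q ω a i`, the sum over `n` of the discounted probability that the jump chain enters `a` from
above at step `n` (`IsMinimalChain.integral_expNeg_additive`). Since downward jumps have size one, a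
path that reaches `0` in finite time has passed through `a` before, so almost surely no path escapes
this count.

On the analytic side, `hitSum` is the minimal non-negative solution of `Q f = ω f` above `a` with
`f(a) = 1`. The recursion for `G` makes `W^{(ω)}(·, N) / W^{(ω)}(a, N)` solve the same equation on
`(a, N)`, with value `1` at `a` and `0` on `[N, ∞)` (`hasSum_rate_mul_W`). A minimum principle, in
which skip-freeness pushes a negative minimum down to `a`, shows that these ratios increase in `N`
and stay below `hitSum`. Their supremum satisfies the first-step equation, so it dominates every
partial sum of `hitSum`, and the limit is `hitSum` (`tendsto_W_ratio`).

The function `ZBar` solves the same equation with the value `1` on `[N, ∞)`. By the minimum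
principle again, the `Z` ratio exceeds the `W` ratio by at most `1 - W(i, N) / W(a, N)`. This bound
tends to `1 - hitSum q 0 a i`, which is `0` because `0`, hence `a`, is hit almost surely
(`ZBar_ratio_sub_mem`). Finally, a resolvent identity between `W^{(ω)}` and `W` and a discrete
Gronwall bound give summability, and the limit can be taken separately in the numerator and the
denominator of the `Z` ratio. -/

theorem hasSum_of_eq {f g : ℕ → ℝ} {s t : ℝ} (h : HasSum f s) (hf : ∀ j, g j = f j)
    (ht : t = s) : HasSum g t := by
  rw [ht, funext hf]
  exact h

/-! ### Rates -/

theorem hasSum_offDiag {q : ℕ → ℕ → ℝ} (hq : IsSingleDeathRate q) (i : ℕ) :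
    HasSum (fun j => if i = j then 0 else q i j) (exitRate q i) := by
  have h := (hq.conservative i).update i 0
  have h2 : Function.update (fun j => q i j) i 0 = fun j => if i = j then 0 else q i j := by
    ext j
    by_cases hj : i = j
    · subst hj; simp
    · simp [hj, Function.update_of_ne (Ne.symm hj)]
  rw [h2] at h
  simpa [exitRate] using h

theorem exitRate_pos {q : ℕ → ℕ → ℝ} (hq : IsSingleDeathRate q) {i : ℕ} (hi : 1 ≤ i) :
    0 < exitRate q i := by
  have h := le_hasSum (hasSum_offDiag hq i) (i - 1) (fun j _ => by
    split_ifs with hj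
    · exact le_rfl
    · exact hq.nonneg i j hj)
  rw [if_neg (by omega)] at h
  exact (hq.down_pos i hi).trans_le h

theorem exitRate_zero {q : ℕ → ℕ → ℝ} (hq : IsSingleDeathRate q) : exitRate q 0 = 0 := by
  simp [exitRate, hq.zero_row]

theorem exitRate_nonneg {q : ℕ → ℕ → ℝ} (hq : IsSingleDeathRate q) (i : ℕ) :
    0 ≤ exitRate q i := by
  rcases Nat.eq_zero_or_pos i with rfl | hi
  · exact (exitRate_zero hq).ge
  · exact (exitRate_pos hq hi).le

theorem jumpProb_nonneg {q : ℕ → ℕ → ℝ} (hq : IsSingleDeathRate q) (i j : ℕ) :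
    0 ≤ jumpProb q i j := by
  unfold jumpProb
  split_ifs with h1 h2 h3
  · exact zero_le_one
  · exact le_rfl
  · exact le_rfl
  · exact div_nonneg (hq.nonneg i j h3) (exitRate_nonneg hq i)

theorem hasSum_jumpProb {q : ℕ → ℕ → ℝ} (hq : IsSingleDeathRate q) (i : ℕ) :
    HasSum (jumpProb q i) 1 := by
  by_cases h : exitRate q i = 0
  · have : jumpProb q i = fun j => if j = i then 1 else 0 := by
      ext j; simp [jumpProb, h, eq_comm]
    rw [this]
    exact hasSum_ite_eq i 1
  · have h1 := (hasSum_offDiag hq i).div_const (exitRate q i)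
    rw [div_self h] at h1
    refine hasSum_of_eq h1 (fun j => ?_) rfl
    rw [jumpProb, if_neg h]
    split_ifs <;> simp

theorem tsum_ofReal_jumpProb {q : ℕ → ℕ → ℝ} (hq : IsSingleDeathRate q) (i : ℕ) :
    ∑' j, ENNReal.ofReal (jumpProb q i j) = 1 := by
  rw [← ENNReal.ofReal_tsum_of_nonneg (jumpProb_nonneg hq i) (hasSum_jumpProb hq i).summable,
    (hasSum_jumpProb hq i).tsum_eq, ENNReal.ofReal_one]

theorem jumpProb_of_pos {q : ℕ → ℕ → ℝ} (hq : IsSingleDeathRate q) {i : ℕ} (hi : 1 ≤ i) (j : ℕ) :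
    jumpProb q i j = if i = j then 0 else q i j / exitRate q i := by
  rw [jumpProb, if_neg (exitRate_pos hq hi).ne']

theorem jumpProb_eq_zero {q : ℕ → ℕ → ℝ} (hq : IsSingleDeathRate q) {i j : ℕ} (h : j + 2 ≤ i) :
    jumpProb q i j = 0 := by
  rw [jumpProb_of_pos hq (by omega), if_neg (by omega), hq.skip_free i j h, zero_div]

theorem sum_range_rate {q : ℕ → ℕ → ℝ} (hq : IsSingleDeathRate q) (i k : ℕ) :
    ∑ j ∈ Finset.range k, q i j = -∑' j, q i (k + j) := by
  have h := (hq.conservative i).summable.sum_add_tsum_nat_add k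
  rw [(hq.conservative i).tsum_eq] at h
  simp_rw [add_comm k]
  linarith

/-! ### Scale functions -/

theorem tail_nonneg {q : ℕ → ℕ → ℝ} (hq : IsSingleDeathRate q) {ω : ℕ → ℝ}
    (hω : ∀ i, 1 ≤ i → 0 ≤ ω i) {n l : ℕ} (hn : 1 ≤ n) (hl : n < l) : 0 ≤ tail q ω n l :=
  add_nonneg (tsum_nonneg fun j => hq.nonneg _ _ (by omega)) (hω n hn)

theorem G_nonneg {q : ℕ → ℕ → ℝ} (hq : IsSingleDeathRate q) {ω : ℕ → ℝ}
    (hω : ∀ i, 1 ≤ i → 0 ≤ ω i) (k : ℕ) : ∀ n, 1 ≤ n → n ≤ k → 0 ≤ G q ω n k := by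
  suffices h : ∀ m n, 1 ≤ n → n ≤ k → k - n = m → 0 ≤ G q ω n k from
    fun n h1 h2 => h _ n h1 h2 rfl
  intro m
  induction m using Nat.strong_induction_on with
  | _ m ih =>
    intro n h1 h2 hm
    rcases h2.eq_or_lt with rfl | h3
    · rw [G_self]; exact zero_le_one
    · rw [G_of_lt q ω h3]
      refine Finset.sum_nonneg fun l hl => ?_
      obtain ⟨hl1, hl2⟩ := Finset.mem_Ioc.mp hl
      exact div_nonneg (mul_nonneg (tail_nonneg hq hω h1 hl1)
        (ih (k - l) (by omega) l (by omega) hl2 rfl)) (hq.down_pos n h1).le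

theorem W_eq_zero (q : ℕ → ℕ → ℝ) (ω : ℕ → ℝ) {i j : ℕ} (h : j ≤ i) : W q ω i j = 0 := by
  rw [W, Finset.Ioc_eq_empty_of_le h, Finset.sum_empty]

theorem W_summand_nonneg {q : ℕ → ℕ → ℝ} (hq : IsSingleDeathRate q) {ω : ℕ → ℝ}
    (hω : ∀ i, 1 ≤ i → 0 ≤ ω i) {j k : ℕ} (h1 : 1 ≤ k) (h2 : k ≤ j) :
    0 ≤ G q ω k j / q j (j - 1) :=
  div_nonneg (G_nonneg hq hω j k h1 h2) (hq.down_pos j (h1.trans h2)).le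

theorem W_antitone {q : ℕ → ℕ → ℝ} (hq : IsSingleDeathRate q) {ω : ℕ → ℝ}
    (hω : ∀ i, 1 ≤ i → 0 ≤ ω i) (j : ℕ) : Antitone fun i => W q ω i j := by
  intro i i' h
  refine Finset.sum_le_sum_of_subset_of_nonneg (Finset.Ioc_subset_Ioc_left h) fun k hk _ => ?_
  obtain ⟨h1, h2⟩ := Finset.mem_Ioc.mp hk
  exact W_summand_nonneg hq hω (by omega) h2

theorem W_nonneg {q : ℕ → ℕ → ℝ} (hq : IsSingleDeathRate q) {ω : ℕ → ℝ}
    (hω : ∀ i, 1 ≤ i → 0 ≤ ω i) (i j : ℕ) : 0 ≤ W q ω i j := by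
  refine Finset.sum_nonneg fun k hk => ?_
  obtain ⟨h1, h2⟩ := Finset.mem_Ioc.mp hk
  exact W_summand_nonneg hq hω (by omega) h2

theorem W_pos {q : ℕ → ℕ → ℝ} (hq : IsSingleDeathRate q) {ω : ℕ → ℝ}
    (hω : ∀ i, 1 ≤ i → 0 ≤ ω i) {i j : ℕ} (h : i < j) : 0 < W q ω i j := by
  have h1 : W q ω (j - 1) j ≤ W q ω i j := W_antitone hq hω j (show i ≤ j - 1 by omega)
  refine lt_of_lt_of_le ?_ h1
  have h2 : Finset.Ioc (j - 1) j = {j} := by ext k; simp; omega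
  rw [W, h2, Finset.sum_singleton, G_self]
  exact div_pos one_pos (hq.down_pos j (by omega))

/-- The scale function `W^{(ω)}(·, u)` solves `Q f = ω f + 1_{u}` on the positive states. -/
theorem hasSum_rate_mul_W {q : ℕ → ℕ → ℝ} (hq : IsSingleDeathRate q) (ω : ℕ → ℝ) {i : ℕ}
    (hi : 1 ≤ i) (u : ℕ) :
    HasSum (fun j => q i j * W q ω j u) (ω i * W q ω i u + if i = u then 1 else 0) := by
  have hs : HasSum (fun j => q i j * W q ω j u) (∑ j ∈ Finset.range u, q i j * W q ω j u) := by
    refine hasSum_sum_of_ne_finset_zero fun j hj => ?_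
    rw [W_eq_zero q ω (by simpa using hj), mul_zero]
  convert hs using 1
  set g : ℕ → ℝ := fun k => G q ω k u / q u (u - 1) with hg
  -- Summation by parts: `W(j, u)` sums `g k` over `k > j`, so partial row sums of `q i` appear as
  -- coefficients. They vanish for `k < i`, equal `q i (i - 1)` at `k = i`, and equal `ω i - tail q
  -- ω i k` for `k > i`. The recursion for `G` cancels the tails.
  have hswap : ∑ j ∈ Finset.range u, q i j * W q ω j u =
      ∑ k ∈ Finset.Ioc 0 u, (∑ j ∈ Finset.range k, q i j) * g k := by
    simp_rw [W, Finset.mul_sum, Finset.sum_mul]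
    refine Finset.sum_comm' fun j k => ?_
    simp only [Finset.mem_range, Finset.mem_Ioc]
    omega
  rw [hswap]
  have hlow : ∀ k, k < i → ∑ j ∈ Finset.range k, q i j = 0 := fun k hk =>
    Finset.sum_eq_zero fun j hj => hq.skip_free i j (by have := Finset.mem_range.mp hj; omega)
  have hmid : ∑ j ∈ Finset.range i, q i j = q i (i - 1) := by
    obtain ⟨m, rfl⟩ : ∃ m, i = m + 1 := ⟨i - 1, by omega⟩
    rw [Finset.sum_range_succ, hlow m (by omega), zero_add, Nat.add_sub_cancel]
  rcases lt_or_ge u i with hui | hiu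
  · rw [W_eq_zero q ω hui.le, if_neg (by omega), Finset.sum_eq_zero]
    · simp
    · intro k hk
      rw [hlow k (by have := Finset.mem_Ioc.mp hk; omega), zero_mul]
  · have hsplit : Finset.Ioc 0 u = Finset.Ioc 0 (i - 1) ∪ (insert i (Finset.Ioc i u)) := by
      ext k; simp only [Finset.mem_Ioc, Finset.mem_union, Finset.mem_insert]; omega
    rw [hsplit, Finset.sum_union, Finset.sum_insert (by simp), hmid,
      Finset.sum_eq_zero (s := Finset.Ioc 0 (i - 1)), zero_add]
    · have hqi := (hq.down_pos i hi).ne'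
      rcases hiu.eq_or_lt with rfl | hlt
      · rw [W_eq_zero q ω le_rfl, if_pos rfl, hg]
        simp only [Finset.Ioc_self, Finset.sum_empty, G_self]
        field_simp
        ring
      · have hgi : q i (i - 1) * g i = ∑ k ∈ Finset.Ioc i u, tail q ω i k * g k := by
          simp only [hg]
          rw [G_of_lt q ω hlt, Finset.sum_div, Finset.mul_sum]
          refine Finset.sum_congr rfl fun k _ => ?_
          field_simp
        rw [hgi, ← Finset.sum_add_distrib, if_neg hlt.ne, add_zero, W, Finset.mul_sum]
        refine Finset.sum_congr rfl fun k _ => ?_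
        rw [sum_range_rate hq, tail]
        ring
    · intro k hk
      rw [hlow k (by have := Finset.mem_Ioc.mp hk; omega), zero_mul]
    · rw [Finset.disjoint_left]
      intro k hk
      simp only [Finset.mem_insert, Finset.mem_Ioc] at hk ⊢
      omega

/-- The function `Z^{(ω)}(·, N)`, with the value `1` instead of `0` on `[N, ∞)`. -/
def ZBar (q : ℕ → ℕ → ℝ) (ω : ℕ → ℝ) (i N : ℕ) : ℝ :=
  1 + ∑ u ∈ Finset.range N, ω u * W q ω i u

theorem Z_eq_ZBar (q : ℕ → ℕ → ℝ) (ω : ℕ → ℝ) {i N : ℕ} (h : i < N) :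
    Z q ω i N = ZBar q ω i N := by
  rw [Z, if_pos h, ZBar]
  congr 1
  refine Finset.sum_subset (fun u hu => ?_) fun u _ hu' => ?_
  · simp at hu ⊢; omega
  · rw [W_eq_zero, mul_zero]
    simp at *; omega

theorem ZBar_eq_one (q : ℕ → ℕ → ℝ) (ω : ℕ → ℝ) {i N : ℕ} (h : N ≤ i) : ZBar q ω i N = 1 := by
  rw [ZBar, Finset.sum_eq_zero, add_zero]
  intro u hu
  rw [W_eq_zero, mul_zero]
  simp at hu; omega

theorem weight_mul_W_nonneg {q : ℕ → ℕ → ℝ} (hq : IsSingleDeathRate q) {ω : ℕ → ℝ}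
    (hω : ∀ i, 1 ≤ i → 0 ≤ ω i) (i u : ℕ) : 0 ≤ ω u * W q ω i u := by
  rcases Nat.eq_zero_or_pos u with rfl | hu
  · rw [W_eq_zero q ω (Nat.zero_le i), mul_zero]
  · exact mul_nonneg (hω u hu) (W_nonneg hq hω i u)

theorem one_le_ZBar {q : ℕ → ℕ → ℝ} (hq : IsSingleDeathRate q) {ω : ℕ → ℝ}
    (hω : ∀ i, 1 ≤ i → 0 ≤ ω i) (i N : ℕ) : 1 ≤ ZBar q ω i N :=
  le_add_of_nonneg_right (Finset.sum_nonneg fun u _ => weight_mul_W_nonneg hq hω i u)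

/-- `Q` annihilates the constant `1`, while the inhomogeneity `1_{i = u}` of `W^{(ω)}(·, u)`,
weighted by `ω u`, supplies exactly the missing `ω i * 1`. This needs `u = i` to occur in the sum,
hence `i < N`. -/
theorem hasSum_rate_mul_ZBar {q : ℕ → ℕ → ℝ} (hq : IsSingleDeathRate q) (ω : ℕ → ℝ) {i N : ℕ}
    (hi : 1 ≤ i) (hN : i < N) :
    HasSum (fun j => q i j * ZBar q ω j N) (ω i * ZBar q ω i N) := by
  have h := (hq.conservative i).add
    (hasSum_sum (s := Finset.range N) fun u _ => (hasSum_rate_mul_W hq ω hi u).mul_left (ω u))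
  refine hasSum_of_eq h (fun j => ?_) ?_
  · rw [ZBar, mul_add, mul_one, Finset.mul_sum]
    congr 1
    exact Finset.sum_congr rfl fun u _ => by ring
  · simp_rw [mul_add, Finset.sum_add_distrib, mul_ite, mul_one, mul_zero]
    rw [Finset.sum_ite_eq, if_pos (Finset.mem_range.mpr hN), ZBar, mul_add, mul_one,
      Finset.mul_sum, zero_add, add_comm]
    congr 1
    exact Finset.sum_congr rfl fun u _ => by ring

/-! ### Maximum and uniqueness principles -/

/-- A function that is superharmonic on `(a, N)` and non-negative at `a` and on `[N, ∞)` is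
non-negative on `[a, ∞)`. -/
theorem nonneg_of_superharmonic {q : ℕ → ℕ → ℝ} (hq : IsSingleDeathRate q) {ω : ℕ → ℝ}
    (hω : ∀ i, 1 ≤ i → 0 ≤ ω i) {a N : ℕ} {d : ℕ → ℝ} (ha : 0 ≤ d a) (hN : ∀ j, N ≤ j → 0 ≤ d j)
    (hd : ∀ i, a < i → i < N → ∃ s, HasSum (fun j => q i j * d j) s ∧ s ≤ ω i * d i)
    {i : ℕ} (hi : a ≤ i) : 0 ≤ d i := by
  by_contra! hneg
  have hiN : i < N := by
    by_contra! h
    exact absurd (hN i h) (not_le.mpr hneg)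
  -- Let `m` be the least point where the minimum over `[a, ∞)` is attained. It exists because a
  -- negative value can occur only in the finite part. At `m` the terms `q m j * (d j - d m)` are
  -- non-negative with sum at most `0`, so `m - 1` attains the minimum as well, a contradiction.
  have hex : ∃ m, a ≤ m ∧ ∀ j, a ≤ j → d m ≤ d j := by
    obtain ⟨m, hm, hmin⟩ := Finset.exists_min_image (Finset.Ico a N) d ⟨i, by simp; omega⟩
    refine ⟨m, (Finset.mem_Ico.mp hm).1, fun j hj => ?_⟩
    rcases lt_or_ge j N with h | h
    · exact hmin j (by simp; omega)
    · exact ((hmin i (by simp; omega)).trans hneg.le).trans (hN j h)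
  classical
  obtain ⟨hma, hmin⟩ := Nat.find_spec hex
  set m := Nat.find hex with hm
  have hdm : d m < 0 := (hmin i hi).trans_lt hneg
  have ham : a < m := by
    rcases hma.eq_or_lt with h | h
    · rw [← h] at hdm; exact absurd ha (not_le.mpr hdm)
    · exact h
  have hmN : m < N := by
    by_contra! h
    exact absurd (hN m h) (not_le.mpr hdm)
  obtain ⟨s, hs, hle⟩ := hd m ham hmN
  have hs2 : HasSum (fun j => q m j * (d j - d m)) s := by
    have h := hs.sub ((hq.conservative m).mul_right (d m))
    rw [zero_mul, sub_zero] at h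
    exact hasSum_of_eq h (fun j => by ring) rfl
  have hterm := le_hasSum hs2 (m - 1) (fun j _ => by
    rcases lt_trichotomy (j + 1) m with h | h | h
    · rw [hq.skip_free m j (by omega), zero_mul]
    · exact mul_nonneg (hq.nonneg _ _ (by omega)) (sub_nonneg.mpr (hmin j (by omega)))
    · rcases eq_or_ne m j with rfl | h'
      · simp
      · exact mul_nonneg (hq.nonneg _ _ h') (sub_nonneg.mpr (hmin j (by omega))))
  have hs0 : s ≤ 0 := hle.trans (mul_nonpos_of_nonneg_of_nonpos (hω m (by omega)) hdm.le)
  have hstep : d (m - 1) ≤ d m := by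
    by_contra! h
    have := mul_pos (hq.down_pos m (by omega)) (sub_pos.mpr h)
    linarith
  exact Nat.find_min hex (m := m - 1) (by omega)
    ⟨by omega, fun j hj => hstep.trans (hmin j hj)⟩

/-- A function that vanishes on `[N, ∞)` and is harmonic on `[1, N]` vanishes. -/
theorem eq_zero_of_harmonic {q : ℕ → ℕ → ℝ} (hq : IsSingleDeathRate q) {ω : ℕ → ℝ} {N : ℕ}
    {d : ℕ → ℝ} (hN : ∀ j, N ≤ j → d j = 0)
    (hd : ∀ i, 1 ≤ i → i ≤ N → HasSum (fun j => q i j * d j) (ω i * d i)) (j : ℕ) : d j = 0 := by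
  -- Downward induction from `N`: once `d` vanishes on `[j + 1, ∞)`, the equation at `j + 1` reduces
  -- to `q (j + 1) j * d j = 0`.
  suffices h : ∀ k j, N ≤ j + k → d j = 0 from h N j (by omega)
  intro k
  induction k with
  | zero => exact fun j hj => hN j hj
  | succ k ih =>
    intro j hj
    rcases hj.eq_or_lt with h | h
    swap
    · exact ih j (by omega)
    have h1 := hd (j + 1) (by omega) (by omega)
    rw [ih (j + 1) (by omega), mul_zero] at h1
    have h2 := hasSum_single (f := fun l => q (j + 1) l * d l) j (fun l hl => by
      rcases lt_or_gt_of_ne hl with h' | h'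
      · simp only [hq.skip_free (j + 1) l (by omega), zero_mul]
      · simp only [ih l (by omega), mul_zero])
    exact (mul_eq_zero.mp (h2.unique h1)).resolve_left (hq.down_pos (j + 1) (by omega)).ne'

/-- A resolvent identity. The difference of the two sides vanishes on `[N, ∞)` and solves `Q f = ω
f` on `[1, N]`, so uniqueness applies. -/
theorem W_eq_add_sum {q : ℕ → ℕ → ℝ} (hq : IsSingleDeathRate q) (ω : ℕ → ℝ) (i N : ℕ) :
    W q ω i N = W q 0 i N + ∑ u ∈ Finset.range N, W q ω i u * (ω u * W q 0 u N) := by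
  refine (sub_eq_zero.mp ?_).symm
  refine eq_zero_of_harmonic hq (ω := ω) (N := N) (d := fun i => W q 0 i N +
    ∑ u ∈ Finset.range N, W q ω i u * (ω u * W q 0 u N) - W q ω i N) (fun j hj => ?_)
    (fun i hi hiN => ?_) i
  · simp only [W_eq_zero q ω hj, W_eq_zero q 0 hj]
    rw [Finset.sum_eq_zero]
    · simp
    · intro u hu
      rw [W_eq_zero q ω (by simp at hu; omega), zero_mul]
  · have h := ((hasSum_rate_mul_W hq 0 hi N).add (hasSum_sum (s := Finset.range N) fun u _ =>
      (hasSum_rate_mul_W hq ω hi u).mul_right (ω u * W q 0 u N))).sub (hasSum_rate_mul_W hq ω hi N)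
    refine hasSum_of_eq h (fun j => ?_) ?_
    · rw [mul_sub, mul_add, Finset.mul_sum]
      congr 2
      exact Finset.sum_congr rfl fun u _ => by ring
    · simp_rw [add_mul, Finset.sum_add_distrib, ite_mul, one_mul, zero_mul]
      rw [Finset.sum_ite_eq]
      simp only [Finset.mem_range, Pi.zero_apply, zero_mul, zero_add, mul_assoc, ← Finset.mul_sum]
      -- At `i = N` the two boundary indicators cancel. For `i < N` the inner indicator provides the
      -- term `ω i * W q 0 i N`.
      rcases hiN.eq_or_lt with rfl | hlt
      · simp [W_eq_zero]
      · simp only [hlt, hlt.ne, if_true, if_false]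
        ring

/-- In the resolvent identity each `W q 0 u N` is at most `W q 0 0 N`, which then factors out. -/
theorem W_le_mul_ZBar {q : ℕ → ℕ → ℝ} (hq : IsSingleDeathRate q) {ω : ℕ → ℝ}
    (hω : ∀ i, 1 ≤ i → 0 ≤ ω i) (i N : ℕ) : W q ω i N ≤ W q 0 0 N * ZBar q ω i N := by
  have h0 : ∀ i, 1 ≤ i → 0 ≤ (0 : ℕ → ℝ) i := fun _ _ => le_rfl
  rw [W_eq_add_sum hq ω i N, ZBar, mul_add, mul_one, Finset.mul_sum]
  refine add_le_add (W_antitone hq h0 N (Nat.zero_le i)) (Finset.sum_le_sum fun u _ => ?_)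
  calc W q ω i u * (ω u * W q 0 u N) = W q 0 u N * (ω u * W q ω i u) := by ring
    _ ≤ _ := mul_le_mul_of_nonneg_right (W_antitone hq h0 N (Nat.zero_le u))
        (weight_mul_W_nonneg hq hω i u)

/-- Discrete Gronwall: the preceding bound gives `ZBar(N + 1) ≤ ZBar(N) * (1 + ω N * W(0, N))`, so
`ZBar` is bounded by the exponential of the assumed convergent series. -/
theorem summable_weight_mul_W {q : ℕ → ℕ → ℝ} (hq : IsSingleDeathRate q) {ω : ℕ → ℝ}
    (hω : ∀ i, 1 ≤ i → 0 ≤ ω i) (hs : Summable fun u => ω (u + 1) * W q 0 0 (u + 1)) (i : ℕ) :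
    Summable fun u => ω u * W q ω i u := by
  have h0 : ∀ i, 1 ≤ i → 0 ≤ (0 : ℕ → ℝ) i := fun _ _ => le_rfl
  have hs' : Summable fun u => ω u * W q 0 0 u :=
    (summable_nat_add_iff (f := fun u => ω u * W q 0 0 u) 1).mp hs
  have hnn : ∀ u, 0 ≤ ω u * W q 0 0 u := fun u => by
    rcases Nat.eq_zero_or_pos u with rfl | hu
    · rw [W_eq_zero q 0 le_rfl, mul_zero]
    · exact mul_nonneg (hω u hu) (W_nonneg hq h0 0 u)
  have hb : ∀ N, ZBar q ω i N ≤ Real.exp (∑ u ∈ Finset.range N, ω u * W q 0 0 u) := by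
    intro N
    induction N with
    | zero => simp [ZBar]
    | succ N ih =>
      have hZ : ZBar q ω i (N + 1) ≤ ZBar q ω i N * (1 + ω N * W q 0 0 N) := by
        have e : ZBar q ω i (N + 1) = ZBar q ω i N + ω N * W q ω i N := by
          rw [ZBar, ZBar, Finset.sum_range_succ]; ring
        rw [e, mul_add, mul_one]
        refine add_le_add le_rfl ?_
        rcases Nat.eq_zero_or_pos N with rfl | hN
        · simp [W_eq_zero]
        · calc ω N * W q ω i N ≤ ω N * (W q 0 0 N * ZBar q ω i N) :=
                mul_le_mul_of_nonneg_left (W_le_mul_ZBar hq hω i N) (hω N hN)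
            _ = _ := by ring
      rw [Finset.sum_range_succ, Real.exp_add]
      refine hZ.trans (mul_le_mul ih ?_ (by linarith [hnn N]) (Real.exp_pos _).le)
      linarith [Real.add_one_le_exp (ω N * W q 0 0 N)]
  refine summable_of_sum_range_le (c := Real.exp (∑' u, ω u * W q 0 0 u))
    (weight_mul_W_nonneg hq hω i) fun N => ?_
  calc ∑ u ∈ Finset.range N, ω u * W q ω i u ≤ ZBar q ω i N := by rw [ZBar]; linarith
    _ ≤ _ := (hb N).trans (Real.exp_le_exp.mpr (hs'.sum_le_tsum _ fun u _ => hnn u))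

theorem ZInf_eq {q : ℕ → ℕ → ℝ} {ω : ℕ → ℝ} {i : ℕ} (hs : Summable fun u => ω u * W q ω i u) :
    ZInf q ω i = 1 + ∑' u, ω u * W q ω i u := by
  rw [ZInf, ← hs.sum_add_tsum_nat_add (i + 1), Finset.sum_eq_zero, zero_add]
  · simp_rw [add_comm (i + 1)]
  · intro u hu
    rw [W_eq_zero q ω (by simp at hu; omega), mul_zero]

theorem tendsto_Z_ZInf {q : ℕ → ℕ → ℝ} {ω : ℕ → ℝ} {i : ℕ}
    (hs : Summable fun u => ω u * W q ω i u) :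
    Tendsto (fun N => Z q ω i N) atTop (𝓝 (ZInf q ω i)) := by
  rw [ZInf_eq hs]
  refine (tendsto_const_nhds.add hs.hasSum.tendsto_sum_nat).congr' ?_
  filter_upwards [eventually_gt_atTop i] with N hN
  rw [Z_eq_ZBar q ω hN, ZBar]

/-! ### Discounted hitting probabilities of the jump chain -/

/-- The expectation `E_i[c(J_0) ⋯ c(J_{n-1}) g(J_n)]` for the jump chain. -/
def stepSum (q : ℕ → ℕ → ℝ) (c g : ℕ → ℝ≥0∞) : ℕ → ℕ → ℝ≥0∞
  | 0, i => g i
  | n + 1, i => c i * ∑' j, ENNReal.ofReal (jumpProb q i j) * stepSum q c g n j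

/-- The factor `q_i / (q_i + ω_i)` on the states above `a`, and `0` elsewhere. -/
def discount (q : ℕ → ℕ → ℝ) (ω : ℕ → ℝ) (a i : ℕ) : ℝ≥0∞ :=
  if a < i then ENNReal.ofReal (exitRate q i / (exitRate q i + ω i)) else 0

/-- The discounted probability that the jump chain started at `i` reaches `a` from above in `n`
steps. -/
def hitStep (q : ℕ → ℕ → ℝ) (ω : ℕ → ℝ) (a n i : ℕ) : ℝ≥0∞ :=
  stepSum q (discount q ω a) (fun j => if j = a then 1 else 0) n i

/-- The discounted probability that the jump chain started at `i` reaches `a` from above. -/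
def hitSum (q : ℕ → ℕ → ℝ) (ω : ℕ → ℝ) (a i : ℕ) : ℝ≥0∞ := ∑' n, hitStep q ω a n i

theorem hitStep_zero (q : ℕ → ℕ → ℝ) (ω : ℕ → ℝ) (a i : ℕ) :
    hitStep q ω a 0 i = if i = a then 1 else 0 := rfl

theorem hitStep_succ (q : ℕ → ℕ → ℝ) (ω : ℕ → ℝ) (a n i : ℕ) :
    hitStep q ω a (n + 1) i =
      discount q ω a i * ∑' j, ENNReal.ofReal (jumpProb q i j) * hitStep q ω a n j := rfl

theorem hitSum_self (q : ℕ → ℕ → ℝ) (ω : ℕ → ℝ) (a : ℕ) : hitSum q ω a a = 1 := by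
  rw [hitSum, tsum_eq_single 0]
  · simp [hitStep_zero]
  · intro n hn
    obtain ⟨m, rfl⟩ := Nat.exists_eq_succ_of_ne_zero hn
    simp [hitStep_succ, discount]

/-- First-step decomposition; the term for zero steps vanishes since `i ≠ a`. -/
theorem hitSum_of_lt (q : ℕ → ℕ → ℝ) (ω : ℕ → ℝ) {a i : ℕ} (h : a < i) :
    hitSum q ω a i =
      discount q ω a i * ∑' j, ENNReal.ofReal (jumpProb q i j) * hitSum q ω a j := by
  rw [hitSum, tsum_eq_zero_add' ENNReal.summable, hitStep_zero, if_neg h.ne', zero_add]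
  simp_rw [hitStep_succ, ENNReal.tsum_mul_left, hitSum, ← ENNReal.tsum_mul_left]
  rw [ENNReal.tsum_comm]

theorem hasSum_jumpProb_mul {q : ℕ → ℕ → ℝ} (hq : IsSingleDeathRate q) {i : ℕ} (hi : 1 ≤ i)
    {f : ℕ → ℝ} {s : ℝ} (h : HasSum (fun j => q i j * f j) s) :
    HasSum (fun j => jumpProb q i j * f j) ((s + exitRate q i * f i) / exitRate q i) := by
  have h1 := (h.add (hasSum_ite_eq i (exitRate q i * f i))).div_const (exitRate q i)
  refine hasSum_of_eq h1 (fun j => ?_) rfl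
  rw [jumpProb_of_pos hq hi]
  rcases eq_or_ne i j with rfl | hj
  · simp [exitRate]
  · rw [if_neg hj, if_neg hj.symm, add_zero]; ring

theorem hasSum_rate_mul {q : ℕ → ℕ → ℝ} (hq : IsSingleDeathRate q) {i : ℕ} (hi : 1 ≤ i)
    {f : ℕ → ℝ} {s : ℝ} (h : HasSum (fun j => jumpProb q i j * f j) s) :
    HasSum (fun j => q i j * f j) (exitRate q i * (s - f i)) := by
  have h1 := (h.mul_left (exitRate q i)).sub (hasSum_ite_eq i (exitRate q i * f i))
  refine hasSum_of_eq h1 (fun j => ?_) (by ring)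
  rw [jumpProb_of_pos hq hi]
  have := (exitRate_pos hq hi).ne'
  rcases eq_or_ne i j with rfl | hj
  · simp [exitRate]
  · rw [if_neg hj, if_neg hj.symm, sub_zero]; field_simp

/-! ### Limits of the ratios of scale functions -/

section ratio

variable {q : ℕ → ℕ → ℝ} {ω : ℕ → ℝ}

theorem hasSum_rate_mul_ratio (hq : IsSingleDeathRate q) (ω : ℕ → ℝ) (a : ℕ) {i N : ℕ}
    (hi : 1 ≤ i) (hN : i < N) :
    HasSum (fun j => q i j * (W q ω j N / W q ω a N)) (ω i * (W q ω i N / W q ω a N)) := by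
  refine hasSum_of_eq ((hasSum_rate_mul_W hq ω hi N).div_const (W q ω a N)) (fun j => ?_) ?_
  · ring
  · rw [if_neg hN.ne]; ring

theorem ratio_nonneg (hq : IsSingleDeathRate q) (hω : ∀ i, 1 ≤ i → 0 ≤ ω i) (a i N : ℕ) :
    0 ≤ W q ω i N / W q ω a N :=
  div_nonneg (W_nonneg hq hω i N) (W_nonneg hq hω a N)

theorem ratio_eq_zero (q : ℕ → ℕ → ℝ) (ω : ℕ → ℝ) (a : ℕ) {i N : ℕ} (h : N ≤ i) :
    W q ω i N / W q ω a N = 0 := by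
  rw [W_eq_zero q ω h, zero_div]

theorem ratio_self (hq : IsSingleDeathRate q) (hω : ∀ i, 1 ≤ i → 0 ≤ ω i) {a N : ℕ} (h : a < N) :
    W q ω a N / W q ω a N = 1 :=
  div_self (W_pos hq hω h).ne'

theorem ratio_le_one (hq : IsSingleDeathRate q) (hω : ∀ i, 1 ≤ i → 0 ≤ ω i) {a i : ℕ}
    (h : a ≤ i) (N : ℕ) : W q ω i N / W q ω a N ≤ 1 :=
  div_le_one_of_le₀ (W_antitone hq hω N h) (W_nonneg hq hω a N)

/-- For `a < N ≤ M` the difference of the two ratios is `0` at `a`, non-negative on `[N, ∞)` and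
harmonic in between, so the minimum principle applies. -/
theorem ratio_mono (hq : IsSingleDeathRate q) (hω : ∀ i, 1 ≤ i → 0 ≤ ω i) {a i : ℕ}
    (h : a ≤ i) : Monotone fun N => W q ω i N / W q ω a N := by
  intro N M hNM
  -- For `N ≤ a` the ratio is `0 / 0`, which is `0` by convention.
  rcases le_or_gt N a with hN | hN
  · simp only [ratio_eq_zero q ω a (hN.trans h)]
    exact ratio_nonneg hq hω a i M
  refine sub_nonneg.mp (nonneg_of_superharmonic hq hω (a := a) (N := N)
    (d := fun i => W q ω i M / W q ω a M - W q ω i N / W q ω a N) ?_ (fun j hj => ?_)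
    (fun i hi hiN => ?_) h)
  · simp only [ratio_self hq hω hN, ratio_self hq hω (hN.trans_le hNM), sub_self, le_refl]
  · simp only [ratio_eq_zero q ω a hj, sub_zero]
    exact ratio_nonneg hq hω a j M
  · refine ⟨_, hasSum_of_eq ((hasSum_rate_mul_ratio hq ω a (by omega) (hiN.trans_le hNM)).sub
      (hasSum_rate_mul_ratio hq ω a (by omega) hiN)) (fun j => mul_sub _ _ _) rfl, ?_⟩
    rw [mul_sub]

theorem discount_mul_tsum_ratio (hq : IsSingleDeathRate q) (hω : ∀ i, 1 ≤ i → 0 ≤ ω i)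
    {a i N : ℕ} (h : a < i) (hN : i < N) :
    discount q ω a i * ∑' j, ENNReal.ofReal (jumpProb q i j) *
      ENNReal.ofReal (W q ω j N / W q ω a N) = ENNReal.ofReal (W q ω i N / W q ω a N) := by
  have hp := exitRate_pos hq (i := i) (by omega)
  have hw := hω i (by omega)
  have hs := hasSum_jumpProb_mul hq (i := i) (by omega)
    (hasSum_rate_mul_ratio hq ω a (by omega) hN)
  simp_rw [← ENNReal.ofReal_mul (jumpProb_nonneg hq i _)]
  rw [← ENNReal.ofReal_tsum_of_nonneg
    (fun j => mul_nonneg (jumpProb_nonneg hq i j) (ratio_nonneg hq hω a j N)) hs.summable,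
    hs.tsum_eq, discount, if_pos h, ← ENNReal.ofReal_mul (by positivity)]
  congr 1
  have : exitRate q i + ω i ≠ 0 := by positivity
  field_simp
  ring

/-- Monotone convergence for the counting measure. -/
theorem tsum_iSup_of_monotone {f : ℕ → ℕ → ℝ≥0∞} (hf : ∀ j, Monotone fun N => f N j) :
    ∑' j, ⨆ N, f N j = ⨆ N, ∑' j, f N j := by
  simp_rw [← lintegral_count]
  exact lintegral_iSup (fun N => measurable_of_countable _) fun N M h j => hf j h

/-- Minimality of `hitSum`, by induction on the number of steps: the supremum of the ratios
satisfies the first-step equation by monotone convergence, so the bound passes from `m` steps to `m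
+ 1`. -/
theorem sum_hitStep_le (hq : IsSingleDeathRate q) (hω : ∀ i, 1 ≤ i → 0 ≤ ω i) (a m : ℕ) :
    ∀ i, a ≤ i → ∑ n ∈ Finset.range m, hitStep q ω a n i ≤
      ⨆ N, ENNReal.ofReal (W q ω i N / W q ω a N) := by
  induction m with
  | zero => simp
  | succ m ih =>
    intro i hi
    rcases hi.eq_or_lt with rfl | hai
    · refine (ENNReal.sum_le_tsum _).trans ?_
      rw [← hitSum, hitSum_self]
      refine le_trans ?_ (le_iSup _ (a + 1))
      rw [ratio_self hq hω (Nat.lt_succ_self a), ENNReal.ofReal_one]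
    rw [Finset.sum_range_succ', hitStep_zero, if_neg hai.ne', add_zero]
    simp_rw [hitStep_succ, ← Finset.mul_sum]
    rw [← Summable.tsum_finsetSum fun _ _ => ENNReal.summable]
    simp_rw [← Finset.mul_sum]
    have hle : ∀ j, ENNReal.ofReal (jumpProb q i j) * ∑ n ∈ Finset.range m, hitStep q ω a n j ≤
        ⨆ N, ENNReal.ofReal (jumpProb q i j) *
          ENNReal.ofReal (W q ω j N / W q ω a N) := by
      intro j
      rw [← ENNReal.mul_iSup]
      rcases le_or_gt a j with hj | hj
      · exact mul_le_mul_right (ih j hj) _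
      -- Here `j < a < i`, so a jump to `j` would skip a state.
      · rw [jumpProb_eq_zero hq (by omega)]
        simp
    have hmono : ∀ j, Monotone fun N => ENNReal.ofReal (jumpProb q i j) *
        ENNReal.ofReal (W q ω j N / W q ω a N) := by
      intro j N M hNM
      rcases le_or_gt a j with hj | hj
      · exact mul_le_mul_right (ENNReal.ofReal_le_ofReal (ratio_mono hq hω hj hNM)) _
      · simp [jumpProb_eq_zero hq (show j + 2 ≤ i by omega)]
    calc _ ≤ discount q ω a i * ∑' j, ⨆ N, ENNReal.ofReal (jumpProb q i j) *
          ENNReal.ofReal (W q ω j N / W q ω a N) :=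
          mul_le_mul_right (ENNReal.tsum_le_tsum hle) _
      _ = ⨆ N, discount q ω a i * ∑' j, ENNReal.ofReal (jumpProb q i j) *
          ENNReal.ofReal (W q ω j N / W q ω a N) := by
          rw [tsum_iSup_of_monotone hmono, ENNReal.mul_iSup]
      _ ≤ _ := by
          refine iSup_le fun N => ?_
          -- The ratio with index `N` satisfies the equation at `i` only when `i < N`, so `N` is
          -- first raised to `max N (i + 1)`.
          refine le_trans (mul_le_mul_right (ENNReal.tsum_le_tsum fun j =>
            hmono j (le_max_left N (i + 1))) _) ?_
          rw [discount_mul_tsum_ratio hq hω hai (by omega)]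
          exact le_iSup (fun N => ENNReal.ofReal (W q ω i N / W q ω a N)) _

theorem hitSum_le_iSup (hq : IsSingleDeathRate q) (hω : ∀ i, 1 ≤ i → 0 ≤ ω i) {a i : ℕ}
    (h : a ≤ i) : hitSum q ω a i ≤ ⨆ N, ENNReal.ofReal (W q ω i N / W q ω a N) := by
  rw [hitSum, ENNReal.tsum_eq_iSup_nat]
  exact iSup_le fun m => sum_hitStep_le hq hω a m i h

theorem hitSum_le_one (hq : IsSingleDeathRate q) (hω : ∀ i, 1 ≤ i → 0 ≤ ω i) {a i : ℕ}
    (h : a ≤ i) : hitSum q ω a i ≤ 1 :=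
  (hitSum_le_iSup hq hω h).trans (iSup_le fun N => by
    rw [← ENNReal.ofReal_one]
    exact ENNReal.ofReal_le_ofReal (ratio_le_one hq hω h N))

theorem hitSum_of_gt (q : ℕ → ℕ → ℝ) (ω : ℕ → ℝ) {a i : ℕ} (h : i < a) : hitSum q ω a i = 0 := by
  rw [hitSum, ENNReal.tsum_eq_zero]
  rintro (_ | n)
  · rw [hitStep_zero, if_neg h.ne]
  · rw [hitStep_succ, discount, if_neg (by omega), zero_mul]

theorem hitSum_ne_top (hq : IsSingleDeathRate q) (hω : ∀ i, 1 ≤ i → 0 ≤ ω i) (a i : ℕ) :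
    hitSum q ω a i ≠ ⊤ := by
  rcases lt_or_ge i a with h | h
  · simp [hitSum_of_gt q ω h]
  · exact ((hitSum_le_one hq hω h).trans_lt ENNReal.one_lt_top).ne

theorem hasSum_rate_mul_hitSum (hq : IsSingleDeathRate q) (hω : ∀ i, 1 ≤ i → 0 ≤ ω i) {a i : ℕ}
    (h : a < i) : HasSum (fun j => q i j * (hitSum q ω a j).toReal)
      (ω i * (hitSum q ω a i).toReal) := by
  have hp := exitRate_pos hq (i := i) (by omega)
  have hw := hω i (by omega)
  have hr : 0 < exitRate q i / (exitRate q i + ω i) := by positivity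
  have he := hitSum_of_lt q ω h
  rw [discount, if_pos h] at he
  -- The discount factor is positive and `hitSum` is finite, so the sum is finite and the equation
  -- can be read in the reals.
  have hne : ∑' j, ENNReal.ofReal (jumpProb q i j) * hitSum q ω a j ≠ ⊤ := by
    intro htop
    rw [htop, ENNReal.mul_top (by simpa using hr)] at he
    exact hitSum_ne_top hq hω a i he
  have hs : HasSum (fun j => jumpProb q i j * (hitSum q ω a j).toReal)
      (∑' j, ENNReal.ofReal (jumpProb q i j) * hitSum q ω a j).toReal := by
    rw [ENNReal.tsum_toReal_eq (ENNReal.ne_top_of_tsum_ne_top hne)]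
    refine hasSum_of_eq (ENNReal.summable_toReal hne).hasSum (fun j => ?_) rfl
    rw [ENNReal.toReal_mul, ENNReal.toReal_ofReal (jumpProb_nonneg hq i j)]
  refine hasSum_of_eq (hasSum_rate_mul hq (by omega) hs) (fun j => rfl) ?_
  have he' := congrArg ENNReal.toReal he
  rw [ENNReal.toReal_mul, ENNReal.toReal_ofReal hr.le] at he'
  rw [he']
  field_simp
  ring

/-- Both functions are harmonic on `(a, N)` and equal `1` at `a`, while on `[N, ∞)` the ratio is
`0`. -/
theorem ratio_le_hitSum (hq : IsSingleDeathRate q) (hω : ∀ i, 1 ≤ i → 0 ≤ ω i) {a i : ℕ}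
    (h : a ≤ i) (N : ℕ) : W q ω i N / W q ω a N ≤ (hitSum q ω a i).toReal := by
  rcases le_or_gt N a with hN | hN
  · rw [ratio_eq_zero q ω a (hN.trans h)]
    exact ENNReal.toReal_nonneg
  refine sub_nonneg.mp (nonneg_of_superharmonic hq hω (a := a) (N := N)
    (d := fun i => (hitSum q ω a i).toReal - W q ω i N / W q ω a N) ?_ (fun j hj => ?_)
    (fun i hi hiN => ?_) h)
  · simp only [ratio_self hq hω hN, hitSum_self, ENNReal.toReal_one, sub_self, le_refl]
  · simp only [ratio_eq_zero q ω a hj, sub_zero]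
    exact ENNReal.toReal_nonneg
  · refine ⟨_, hasSum_of_eq ((hasSum_rate_mul_hitSum hq hω hi).sub
      (hasSum_rate_mul_ratio hq ω a (by omega) hiN)) (fun j => mul_sub _ _ _) rfl, ?_⟩
    rw [mul_sub]

theorem tendsto_W_ratio (hq : IsSingleDeathRate q) (hω : ∀ i, 1 ≤ i → 0 ≤ ω i) {a i : ℕ}
    (h : a ≤ i) : Tendsto (fun N => W q ω i N / W q ω a N) atTop
      (𝓝 (hitSum q ω a i).toReal) := by
  have hsup : ⨆ N, ENNReal.ofReal (W q ω i N / W q ω a N) = hitSum q ω a i := by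
    refine le_antisymm (iSup_le fun N => ?_) (hitSum_le_iSup hq hω h)
    exact ENNReal.ofReal_le_of_le_toReal (ratio_le_hitSum hq hω h N)
  have ht := tendsto_atTop_iSup (f := fun N => ENNReal.ofReal (W q ω i N / W q ω a N))
    fun N M hNM => ENNReal.ofReal_le_ofReal (ratio_mono hq hω h hNM)
  rw [hsup] at ht
  refine ((ENNReal.tendsto_toReal (hitSum_ne_top hq hω a i)).comp ht).congr fun N => ?_
  exact ENNReal.toReal_ofReal (ratio_nonneg hq hω a i N)

/-- The difference `d` solves `Q d = ω d` on `(a, N)`, is `0` at `a` and `1 / ZBar(a, N)`, a number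
in `[0, 1]`, on `[N, ∞)`. Hence `d ≥ 0`, so `Q d ≥ 0`, and `d` lies below the `Q`-harmonic function
`1 - W(·, N) / W(a, N)`, whose boundary values are `0` and `1`. -/
theorem ZBar_ratio_sub_mem (hq : IsSingleDeathRate q) (hω : ∀ i, 1 ≤ i → 0 ≤ ω i) {a i N : ℕ}
    (h : a ≤ i) (hN : a < N) :
    0 ≤ ZBar q ω i N / ZBar q ω a N - W q ω i N / W q ω a N ∧
    ZBar q ω i N / ZBar q ω a N - W q ω i N / W q ω a N ≤ 1 - W q 0 i N / W q 0 a N := by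
  have h0 : ∀ i, 1 ≤ i → 0 ≤ (0 : ℕ → ℝ) i := fun _ _ => le_rfl
  set d : ℕ → ℝ := fun i => ZBar q ω i N / ZBar q ω a N - W q ω i N / W q ω a N with hd
  have hZ := one_le_ZBar hq hω a N
  have hda : d a = 0 := by
    simp only [hd, ratio_self hq hω hN, div_self (zero_lt_one.trans_le hZ).ne', sub_self]
  have hdN : ∀ j, N ≤ j → d j = 1 / ZBar q ω a N := fun j hj => by
    simp only [hd, ratio_eq_zero q ω a hj, ZBar_eq_one q ω hj, sub_zero]
  have hdh : ∀ i, a < i → i < N → HasSum (fun j => q i j * d j) (ω i * d i) := by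
    intro i hi hiN
    refine hasSum_of_eq (((hasSum_rate_mul_ZBar hq ω (by omega) hiN).div_const
      (ZBar q ω a N)).sub (hasSum_rate_mul_ratio hq ω a (by omega) hiN)) (fun j => ?_) ?_
    · simp only [hd]; ring
    · simp only [hd]; ring
  have hnn : ∀ i, a ≤ i → 0 ≤ d i := fun i hi =>
    nonneg_of_superharmonic hq hω (N := N) hda.ge
      (fun j hj => by rw [hdN j hj]; positivity) (fun i hi hiN => ⟨_, hdh i hi hiN, le_rfl⟩) hi
  refine ⟨hnn i h, sub_nonneg.mp (nonneg_of_superharmonic hq h0 (a := a) (N := N)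
    (d := fun i => 1 - W q 0 i N / W q 0 a N - d i) ?_ (fun j hj => ?_) (fun i hi hiN => ?_) h)⟩
  · simp only [hda, ratio_self hq h0 hN, sub_self, le_refl]
  · simp only [hdN j hj, ratio_eq_zero q 0 a hj, sub_zero]
    rw [sub_nonneg]
    exact div_le_one_of_le₀ hZ (by linarith)
  · refine ⟨_, hasSum_of_eq (((hq.conservative i).sub
      (hasSum_rate_mul_ratio hq 0 a (by omega) hiN)).sub (hdh i hi hiN)) (fun j => by ring) rfl, ?_⟩
    have := mul_nonneg (hω i (by omega)) (hnn i hi.le)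
    simp only [Pi.zero_apply, zero_mul]
    linarith

theorem tendsto_Z_ratio (hq : IsSingleDeathRate q) (hω : ∀ i, 1 ≤ i → 0 ≤ ω i) {a i : ℕ}
    (h : a ≤ i) (hone : hitSum q 0 a i = 1) :
    Tendsto (fun N => Z q ω i N / Z q ω a N) atTop (𝓝 (hitSum q ω a i).toReal) := by
  have h0 : ∀ i, 1 ≤ i → 0 ≤ (0 : ℕ → ℝ) i := fun _ _ => le_rfl
  have ht := tendsto_W_ratio hq hω h
  have ht0 := (tendsto_W_ratio hq h0 h).const_sub 1
  rw [hone, ENNReal.toReal_one, sub_self] at ht0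
  have hd : Tendsto (fun N => ZBar q ω i N / ZBar q ω a N - W q ω i N / W q ω a N) atTop
      (𝓝 0) := by
    refine tendsto_of_tendsto_of_tendsto_of_le_of_le' tendsto_const_nhds ht0 ?_ ?_
    · filter_upwards [eventually_gt_atTop a] with N hN using (ZBar_ratio_sub_mem hq hω h hN).1
    · filter_upwards [eventually_gt_atTop a] with N hN using (ZBar_ratio_sub_mem hq hω h hN).2
  have := ht.add hd
  rw [add_zero] at this
  refine this.congr' ?_
  filter_upwards [eventually_gt_atTop i] with N hN
  rw [Z_eq_ZBar q ω hN, Z_eq_ZBar q ω (h.trans_lt hN)]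
  ring

end ratio

/-! ### Exponential holding times -/

theorem measurable_expNeg : Measurable expNeg := by
  unfold expNeg
  exact Measurable.ite (measurableSet_singleton _) measurable_const (by fun_prop)

theorem expNeg_zero : expNeg 0 = 1 := by simp [expNeg]

theorem expNeg_nonneg (x : ℝ≥0∞) : 0 ≤ expNeg x := by
  unfold expNeg
  split_ifs
  · exact le_rfl
  · exact (Real.exp_pos _).le

theorem expNeg_add (x y : ℝ≥0∞) : expNeg (x + y) = expNeg x * expNeg y := by
  unfold expNeg
  by_cases hx : x = ⊤
  · simp [hx]
  by_cases hy : y = ⊤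
  · simp [hy]
  rw [if_neg hx, if_neg hy, if_neg (ENNReal.add_ne_top.mpr ⟨hx, hy⟩), ENNReal.toReal_add hx hy,
    neg_add, Real.exp_add]

theorem expNeg_sum (u : ℕ → ℝ≥0∞) (n : ℕ) :
    expNeg (∑ k ∈ Finset.range n, u k) = ∏ k ∈ Finset.range n, expNeg (u k) := by
  induction n with
  | zero => simp [expNeg_zero]
  | succ n ih => rw [Finset.sum_range_succ, Finset.prod_range_succ, expNeg_add, ih]

theorem lintegral_exp_Ioi {r : ℝ} (hr : 0 < r) (c : ℝ) :
    ∫⁻ t in Set.Ioi c, ENNReal.ofReal (r * Real.exp (-(r * t))) =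
      ENNReal.ofReal (Real.exp (-(r * c))) := by
  have hint : IntegrableOn (fun t => r * Real.exp (-(r * t))) (Set.Ioi c) := by
    simpa only [neg_mul, IntegrableOn] using (integrableOn_exp_mul_Ioi (neg_neg_of_pos hr) c).const_mul r
  rw [← ofReal_integral_eq_lintegral_ofReal hint
    (Eventually.of_forall fun t => by positivity), integral_const_mul]
  have := integral_exp_mul_Ioi (neg_neg_of_pos hr) c
  simp only [neg_mul] at this
  rw [this]
  congr 1
  field_simp

/-- Writing `e^{-rs}` as an integral of `r e^{-rt}` over `t ≥ s` lets the Laplace transform be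
computed from tail probabilities alone; `s = ⊤` gives `0` on both sides. -/
theorem ofReal_expNeg_eq_lintegral {r : ℝ} (hr : 0 < r) {s : ℝ≥0∞} (hs : 0 < s) :
    ENNReal.ofReal (expNeg (ENNReal.ofReal r * s)) = ∫⁻ t in Set.Ioi (0 : ℝ),
      if s ≤ ENNReal.ofReal t then ENNReal.ofReal (r * Real.exp (-(r * t))) else 0 := by
  rcases eq_or_ne s ⊤ with rfl | hst
  · rw [ENNReal.mul_top (by simpa using hr)]
    simp [expNeg]
  lift s to ℝ≥0 using hst
  have hs' : 0 < (s : ℝ) := by exact_mod_cast hs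
  have h1 : ∀ t : ℝ, (if (s : ℝ≥0∞) ≤ ENNReal.ofReal t then
      ENNReal.ofReal (r * Real.exp (-(r * t))) else 0) =
      (Set.Ici (s : ℝ)).indicator (fun t => ENNReal.ofReal (r * Real.exp (-(r * t)))) t := by
    intro t
    have : (s : ℝ≥0∞) ≤ ENNReal.ofReal t ↔ (s : ℝ) ≤ t := by
      rw [← ENNReal.ofReal_coe_nnreal, ENNReal.ofReal_le_ofReal_iff']
      constructor
      · rintro (h | h) <;> linarith
      · exact Or.inl
    simp only [this, Set.indicator_apply, Set.mem_Ici]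
  simp_rw [h1]
  rw [setLIntegral_indicator measurableSet_Ici,
    Set.inter_eq_left.mpr (Set.Ici_subset_Ioi.mpr hs'),
    setLIntegral_congr Ioi_ae_eq_Ici.symm, lintegral_exp_Ioi hr]
  congr 1
  rw [expNeg, if_neg (ENNReal.mul_ne_top ENNReal.ofReal_ne_top ENNReal.coe_ne_top),
    ENNReal.toReal_mul, ENNReal.toReal_ofReal hr.le, ENNReal.coe_toReal]

/-- The Laplace transform of an exponential variable, given through its tail. -/
theorem lintegral_expNeg_of_tail {Ω : Type*} [MeasurableSpace Ω] (ν : Measure Ω) [SFinite ν]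
    {S : Ω → ℝ≥0∞} (hS : Measurable S) {l r : ℝ} (hl : 0 < l) (hr : 0 ≤ r) {C : ℝ≥0∞}
    (hC : C ≠ ⊤)
    (h : ∀ t : ℝ≥0, ν {x | (t : ℝ≥0∞) < S x} = C * ENNReal.ofReal (Real.exp (-(l * t)))) :
    ∫⁻ x, (if 0 < S x then ENNReal.ofReal (expNeg (ENNReal.ofReal r * S x)) else 0) ∂ν =
      C * ENNReal.ofReal (l / (l + r)) := by
  have hpos : ν {x | 0 < S x} = C := by simpa using h 0
  have hmpos : MeasurableSet {x | 0 < S x} := measurableSet_lt measurable_const hS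
  rcases hr.eq_or_lt with rfl | hr
  · simp only [ENNReal.ofReal_zero, zero_mul, expNeg_zero, ENNReal.ofReal_one, add_zero,
      div_self hl.ne', mul_one]
    have : ∀ x, (if 0 < S x then (1 : ℝ≥0∞) else 0) = {x | 0 < S x}.indicator 1 x := fun x => by
      simp [Set.indicator_apply]
    simp_rw [this]
    rw [lintegral_indicator_one hmpos, hpos]
  have hpt : ∀ x, (if 0 < S x then ENNReal.ofReal (expNeg (ENNReal.ofReal r * S x)) else 0) =
      ∫⁻ t in Set.Ioi (0 : ℝ), if 0 < S x ∧ S x ≤ ENNReal.ofReal t then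
        ENNReal.ofReal (r * Real.exp (-(r * t))) else 0 := by
    intro x
    by_cases hx : 0 < S x
    · simp only [hx, if_true, true_and]
      exact ofReal_expNeg_eq_lintegral hr hx
    · simp [hx]
  simp_rw [hpt]
  -- By Tonelli, the integrand becomes `r e^{-rt}` times the mass of `{0 < S ≤ t}`, which is `C (1 -
  -- e^{-lt})`.
  rw [lintegral_lintegral_swap]
  swap
  · refine Measurable.aemeasurable (Measurable.ite ?_ (by fun_prop) measurable_const)
    have hm1 : Measurable fun z : Ω × ℝ => S z.1 := hS.comp measurable_fst
    exact (measurableSet_lt measurable_const hm1).inter (measurableSet_le hm1 (by fun_prop))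
  have hin : ∀ t ∈ Set.Ioi (0 : ℝ), ∫⁻ x, (if 0 < S x ∧ S x ≤ ENNReal.ofReal t then
        ENNReal.ofReal (r * Real.exp (-(r * t))) else 0) ∂ν =
      C * ENNReal.ofReal (r * Real.exp (-(r * t)) - r * Real.exp (-((r + l) * t))) := by
    intro t ht
    have ht0 : (0 : ℝ) ≤ t := le_of_lt ht
    have hset : {x | 0 < S x ∧ S x ≤ ENNReal.ofReal t} =
        {x | 0 < S x} \ {x | ((t.toNNReal : ℝ≥0) : ℝ≥0∞) < S x} := by
      ext x
      simp [ENNReal.ofReal, not_lt]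
    have hm : MeasurableSet {x | ((t.toNNReal : ℝ≥0) : ℝ≥0∞) < S x} :=
      measurableSet_lt measurable_const hS
    have hν : ν {x | 0 < S x ∧ S x ≤ ENNReal.ofReal t} =
        C * ENNReal.ofReal (1 - Real.exp (-(l * t))) := by
      have hsub : {x | ((t.toNNReal : ℝ≥0) : ℝ≥0∞) < S x} ⊆ {x | 0 < S x} :=
        fun x hx => lt_of_le_of_lt zero_le (Set.mem_ofPred_eq ▸ hx)
      rw [hset, measure_sdiff hsub hm.nullMeasurableSet, hpos, h,
        Real.coe_toNNReal t ht0, ENNReal.ofReal_sub _ (Real.exp_pos _).le, ENNReal.ofReal_one,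
        ENNReal.mul_sub (fun _ _ => hC), mul_one]
      rw [h]
      exact ENNReal.mul_ne_top hC ENNReal.ofReal_ne_top
    have : ∀ x, (if 0 < S x ∧ S x ≤ ENNReal.ofReal t then
        ENNReal.ofReal (r * Real.exp (-(r * t))) else 0) =
        {x | 0 < S x ∧ S x ≤ ENNReal.ofReal t}.indicator
          (fun _ => ENNReal.ofReal (r * Real.exp (-(r * t)))) x := fun x => by
      simp [Set.indicator_apply]
    simp_rw [this]
    rw [lintegral_indicator_const (hset ▸ hmpos.diff hm), hν, mul_left_comm,
      ← ENNReal.ofReal_mul (by positivity), add_mul, neg_add, Real.exp_add]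
    congr 2
    ring
  rw [setLIntegral_congr_fun measurableSet_Ioi hin, lintegral_const_mul _ (by fun_prop)]
  congr 1
  have hrl : 0 < r + l := by positivity
  -- The subtracted term is `r / (r + l)` times the exponential density of parameter `r + l`, so the
  -- integral is `1 - r / (r + l) = l / (l + r)`.
  have hsub : ∀ t : ℝ, ENNReal.ofReal (r * Real.exp (-(r * t)) - r * Real.exp (-((r + l) * t))) =
      ENNReal.ofReal (r * Real.exp (-(r * t))) - ENNReal.ofReal (r / (r + l)) *
        ENNReal.ofReal ((r + l) * Real.exp (-((r + l) * t))) := by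
    intro t
    rw [ENNReal.ofReal_sub _ (by positivity), ← ENNReal.ofReal_mul (by positivity)]
    congr 2
    field_simp
  have hle : ∀ t ∈ Set.Ioi (0 : ℝ), ENNReal.ofReal (r / (r + l)) *
        ENNReal.ofReal ((r + l) * Real.exp (-((r + l) * t))) ≤
        ENNReal.ofReal (r * Real.exp (-(r * t))) := by
    intro t ht
    rw [← ENNReal.ofReal_mul (by positivity)]
    refine ENNReal.ofReal_le_ofReal ?_
    have e : r / (r + l) * ((r + l) * Real.exp (-((r + l) * t))) =
        r * Real.exp (-((r + l) * t)) := by field_simp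
    rw [e]
    refine mul_le_mul_of_nonneg_left (Real.exp_le_exp.mpr ?_) hr.le
    nlinarith [Set.mem_Ioi.mp ht]
  have hfin : ∫⁻ t in Set.Ioi (0 : ℝ), ENNReal.ofReal (r / (r + l)) *
      ENNReal.ofReal ((r + l) * Real.exp (-((r + l) * t))) = ENNReal.ofReal (r / (r + l)) := by
    rw [lintegral_const_mul _ (by fun_prop), lintegral_exp_Ioi hrl]
    simp
  simp_rw [hsub]
  rw [lintegral_sub (by fun_prop) (by rw [hfin]; exact ENNReal.ofReal_ne_top)
    ((ae_restrict_iff' measurableSet_Ioi).mpr (Eventually.of_forall hle)), hfin,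
    lintegral_exp_Ioi hr, ← ENNReal.ofReal_sub _ (by positivity)]
  congr 1
  simp only [mul_zero, neg_zero, Real.exp_zero]
  field_simp
  ring

/-! ### Laws of the visited states and the holding times -/

/-- The function `φ` has integral `v` against the exponential law of parameter `l`, tested on
variables on `Ω`. -/
structure ExpIntegral (Ω : Type*) [MeasurableSpace Ω] (l : ℝ) (φ : ℝ≥0∞ → ℝ≥0∞) (v : ℝ≥0∞) :
    Prop where
  measurable : Measurable φ
  ne_top : v ≠ ⊤
  lintegral_eq : ∀ (ν : Measure Ω) [SFinite ν] (S : Ω → ℝ≥0∞), Measurable S → ∀ C : ℝ≥0∞, C ≠ ⊤ →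
    (∀ t : ℝ≥0, ν {x | (t : ℝ≥0∞) < S x} = C * ENNReal.ofReal (Real.exp (-(l * t)))) →
    ∫⁻ x, φ (S x) ∂ν = C * v

theorem lintegral_lt_ite {Ω : Type*} [MeasurableSpace Ω] (ν : Measure Ω) {S : Ω → ℝ≥0∞}
    (hS : Measurable S) (t : ℝ≥0) :
    ∫⁻ x, (if (t : ℝ≥0∞) < S x then 1 else 0) ∂ν = ν {x | (t : ℝ≥0∞) < S x} := by
  rw [← lintegral_indicator_one (measurableSet_lt measurable_const hS)]
  refine lintegral_congr fun x => ?_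
  simp [Set.indicator_apply]

theorem expIntegral_tail (Ω : Type*) [MeasurableSpace Ω] (l : ℝ) (t : ℝ≥0) :
    ExpIntegral Ω l (fun s => if (t : ℝ≥0∞) < s then 1 else 0)
      (ENNReal.ofReal (Real.exp (-(l * t)))) where
  measurable := Measurable.ite (measurableSet_lt measurable_const measurable_id)
    measurable_const measurable_const
  ne_top := ENNReal.ofReal_ne_top
  lintegral_eq ν _ S hS C _ h := by rw [lintegral_lt_ite ν hS, h]

theorem expIntegral_pos (Ω : Type*) [MeasurableSpace Ω] (l : ℝ) :
    ExpIntegral Ω l (fun s => if 0 < s then 1 else 0) 1 := by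
  simpa using expIntegral_tail Ω l 0

theorem expIntegral_zero (Ω : Type*) [MeasurableSpace Ω] (l : ℝ) :
    ExpIntegral Ω l (fun _ => 0) 0 where
  measurable := measurable_const
  ne_top := ENNReal.zero_ne_top
  lintegral_eq ν _ S hS C _ h := by simp

theorem expIntegral_expNeg (Ω : Type*) [MeasurableSpace Ω] {l r : ℝ} (hl : 0 < l) (hr : 0 ≤ r) :
    ExpIntegral Ω l (fun s => if 0 < s then ENNReal.ofReal (expNeg (ENNReal.ofReal r * s)) else 0)
      (ENNReal.ofReal (l / (l + r))) where
  measurable := Measurable.ite (measurableSet_lt measurable_const measurable_id)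
    (measurable_expNeg.comp (by fun_prop)).ennreal_ofReal measurable_const
  ne_top := ENNReal.ofReal_ne_top
  lintegral_eq ν _ S hS C hC h := lintegral_expNeg_of_tail ν hS hl hr hC h

/-- The probability that the jump chain started at `i` begins with `x 0, …, x n`. -/
def pathWeight (q : ℕ → ℕ → ℝ) (i : ℕ) (x : ℕ → ℕ) (n : ℕ) : ℝ≥0∞ :=
  (if x 0 = i then 1 else 0) * ∏ k ∈ Finset.range n, ENNReal.ofReal (jumpProb q (x k) (x (k + 1)))

theorem pathWeight_ne_top (q : ℕ → ℕ → ℝ) (i : ℕ) (x : ℕ → ℕ) (n : ℕ) :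
    pathWeight q i x n ≠ ⊤ :=
  ENNReal.mul_ne_top (by split_ifs <;> simp) (ENNReal.prod_ne_top fun _ _ => ENNReal.ofReal_ne_top)

section chain

variable {q : ℕ → ℕ → ℝ} {Ω : Type*} [MeasurableSpace Ω] {P : ℕ → Measure Ω} {J : ℕ → Ω → ℕ}
  {S : ℕ → Ω → ℝ≥0∞}

theorem IsMinimalChain.law_eq (hc : IsMinimalChain q P J S) (hq : IsSingleDeathRate q) (i n : ℕ)
    (x : ℕ → ℕ) (t : ℕ → ℝ≥0) :
    P i {w | ∀ k ≤ n, J k w = x k ∧ (t k : ℝ≥0∞) < S k w} = pathWeight q i x n *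
      ∏ k ∈ Finset.range (n + 1), ENNReal.ofReal (Real.exp (-(exitRate q (x k) * t k))) := by
  have h1 : 0 ≤ ∏ k ∈ Finset.range n, jumpProb q (x k) (x (k + 1)) :=
    Finset.prod_nonneg fun k _ => jumpProb_nonneg hq _ _
  have h2 : (0 : ℝ) ≤ if x 0 = i then 1 else 0 := by split_ifs <;> norm_num
  rw [hc.law, ENNReal.ofReal_mul (mul_nonneg h2 h1), ENNReal.ofReal_mul h2,
    ENNReal.ofReal_prod_of_nonneg fun k _ => jumpProb_nonneg hq _ _,
    ENNReal.ofReal_prod_of_nonneg fun k _ => (Real.exp_pos _).le, pathWeight]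
  congr 2
  split_ifs <;> simp

theorem IsMinimalChain.measurable_factor (hc : IsMinimalChain q P J S) {φ : ℝ≥0∞ → ℝ≥0∞}
    (hφ : Measurable φ) (k y : ℕ) : Measurable fun w => if J k w = y then φ (S k w) else 0 :=
  Measurable.ite (hc.measurable_state k (measurableSet_singleton y))
    (hφ.comp (hc.measurable_hold k)) measurable_const

/-- The law of the chain prescribes only joint tails. Conditional independence for general test
functions is obtained by replacing the tail indicators one coordinate at a time. -/
theorem IsMinimalChain.lintegral_prod (hc : IsMinimalChain q P J S) (hq : IsSingleDeathRate q)
    (i n : ℕ) (x : ℕ → ℕ) (φ : ℕ → ℝ≥0∞ → ℝ≥0∞) (v : ℕ → ℝ≥0∞)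
    (hφ : ∀ k, ExpIntegral Ω (exitRate q (x k)) (φ k) (v k)) :
    ∫⁻ w, ∏ k ∈ Finset.range (n + 1), (if J k w = x k then φ k (S k w) else 0) ∂(P i) =
      pathWeight q i x n * ∏ k ∈ Finset.range (n + 1), v k := by
  have := hc.prob i
  classical
  -- `A` is the set of coordinates whose test function is already arbitrary; elsewhere it is a tail
  -- indicator.
  suffices h : ∀ A : Finset ℕ, A ⊆ Finset.range (n + 1) → ∀ (φ : ℕ → ℝ≥0∞ → ℝ≥0∞) (v : ℕ → ℝ≥0∞),
      (∀ k, ExpIntegral Ω (exitRate q (x k)) (φ k) (v k)) →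
      (∀ k ∉ A, ∃ t : ℝ≥0, φ k = (fun s => if (t : ℝ≥0∞) < s then 1 else 0) ∧
        v k = ENNReal.ofReal (Real.exp (-(exitRate q (x k) * t)))) →
      ∫⁻ w, ∏ k ∈ Finset.range (n + 1), (if J k w = x k then φ k (S k w) else 0) ∂(P i) =
        pathWeight q i x n * ∏ k ∈ Finset.range (n + 1), v k by
    set φ' : ℕ → ℝ≥0∞ → ℝ≥0∞ := fun k => if k ∈ Finset.range (n + 1) then φ k else
      fun s => if ((0 : ℝ≥0) : ℝ≥0∞) < s then 1 else 0 with hφ'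
    set v' : ℕ → ℝ≥0∞ := fun k => if k ∈ Finset.range (n + 1) then v k else
      ENNReal.ofReal (Real.exp (-(exitRate q (x k) * (0 : ℝ≥0)))) with hv'
    have h1 := h (Finset.range (n + 1)) subset_rfl φ' v' (fun k => by
      by_cases hk : k ∈ Finset.range (n + 1)
      · simpa only [hφ', hv', hk, if_true] using hφ k
      · simpa only [hφ', hv', hk, if_false] using expIntegral_tail Ω _ 0)
      (fun k hk => ⟨0, by simp only [hφ', hk, if_false], by simp only [hv', hk, if_false]⟩)
    rw [Finset.prod_congr rfl fun k hk => show v' k = v k by simp only [hv', hk, if_true]] at h1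
    rw [← h1]
    refine lintegral_congr fun w => Finset.prod_congr rfl fun k hk => ?_
    simp only [hφ', hk, if_true]
  intro A
  induction A using Finset.induction_on with
  | empty =>
    intro _ φ v _ ht
    choose t ht1 ht2 using fun k => ht k (Finset.notMem_empty k)
    simp_rw [ht1, ht2]
    rw [← hc.law_eq hq i n x t]
    have hm : MeasurableSet {w | ∀ k ≤ n, J k w = x k ∧ (t k : ℝ≥0∞) < S k w} := by
      simp only [Set.ofPred_forall]
      exact MeasurableSet.iInter fun k => MeasurableSet.iInter fun _ =>
        (hc.measurable_state k (measurableSet_singleton (x k))).inter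
          (measurableSet_lt measurable_const (hc.measurable_hold k))
    rw [← lintegral_indicator_one hm]
    refine lintegral_congr fun w => ?_
    simp only [← ite_and]
    rw [Finset.prod_ite_zero]
    simp only [Finset.prod_const_one, Set.indicator_apply, Set.mem_ofPred_eq, Pi.one_apply,
      Finset.mem_range, Nat.lt_succ_iff]
  | insert m A hm ih =>
    intro hA φ v hφ ht
    have hmn : m ∈ Finset.range (n + 1) := hA (Finset.mem_insert_self m A)
    set g : Ω → ℝ≥0∞ := fun w => (if J m w = x m then 1 else 0) *
      ∏ k ∈ (Finset.range (n + 1)).erase m, (if J k w = x k then φ k (S k w) else 0) with hg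
    have hgm : Measurable g :=
      (Measurable.ite (hc.measurable_state m (measurableSet_singleton _))
        measurable_const measurable_const).mul (Finset.measurable_prod _ fun k _ =>
          hc.measurable_factor (hφ k).measurable k (x k))
    set C : ℝ≥0∞ := pathWeight q i x n * ∏ k ∈ (Finset.range (n + 1)).erase m, v k with hC
    have hCt : C ≠ ⊤ := ENNReal.mul_ne_top (pathWeight_ne_top q i x n)
      (ENNReal.prod_ne_top fun k _ => (hφ k).ne_top)
    have hfac : ∀ (ψ : ℕ → ℝ≥0∞ → ℝ≥0∞) (w : Ω), (∀ k, k ≠ m → ψ k = φ k) →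
        ∏ k ∈ Finset.range (n + 1), (if J k w = x k then ψ k (S k w) else 0) =
          g w * ψ m (S m w) := by
      intro ψ w hψ
      rw [← Finset.mul_prod_erase _ _ hmn, hg]
      simp only
      rw [Finset.prod_congr rfl fun k hk => show (if J k w = x k then ψ k (S k w) else 0) =
        (if J k w = x k then φ k (S k w) else 0) by rw [hψ k (Finset.ne_of_mem_erase hk)]]
      split_ifs <;> ring
    -- With the other factors frozen into the density `g`, the tail of `S m` is given by the
    -- induction hypothesis with a tail indicator at `m`. Thus `S m` is exponential of total mass
    -- `C`, and `hφ m` applies.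
    have htail : ∀ t : ℝ≥0, (P i).withDensity g {w | (t : ℝ≥0∞) < S m w} =
        C * ENNReal.ofReal (Real.exp (-(exitRate q (x m) * t))) := by
      intro t
      have hi := ih ((Finset.subset_insert m A).trans hA)
        (Function.update φ m fun s => if (t : ℝ≥0∞) < s then 1 else 0)
        (Function.update v m (ENNReal.ofReal (Real.exp (-(exitRate q (x m) * t)))))
        (fun k => by
          rcases eq_or_ne k m with rfl | hk
          · simpa only [Function.update_self] using expIntegral_tail Ω _ t
          · simpa only [Function.update_of_ne hk] using hφ k)
        (fun k hk => by
          rcases eq_or_ne k m with rfl | hkm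
          · exact ⟨t, by simp only [Function.update_self], by simp only [Function.update_self]⟩
          · simpa only [Function.update_of_ne hkm] using ht k (by simp [hk, hkm]))
      simp_rw [fun w => hfac (Function.update φ m fun s => if (t : ℝ≥0∞) < s then 1 else 0) w
        fun k hk => Function.update_of_ne hk _ _, Function.update_self] at hi
      rw [← lintegral_lt_ite _ (hc.measurable_hold m),
        lintegral_withDensity_eq_lintegral_mul _ hgm
          (g := fun w => if (t : ℝ≥0∞) < S m w then 1 else 0) ((expIntegral_tail Ω 0 t).measurable.comp (hc.measurable_hold m))]
      refine hi.trans ?_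
      rw [← Finset.mul_prod_erase _ _ hmn, Function.update_self, hC,
        Finset.prod_congr rfl fun k hk => Function.update_of_ne (Finset.ne_of_mem_erase hk) _ v]
      ring
    have hint := (hφ m).lintegral_eq _ (S m) (hc.measurable_hold m) C hCt htail
    rw [lintegral_withDensity_eq_lintegral_mul _ hgm (g := fun w => φ m (S m w))
      ((hφ m).measurable.comp (hc.measurable_hold m))] at hint
    simp_rw [fun w => hfac φ w fun _ _ => rfl]
    refine hint.trans ?_
    rw [← Finset.mul_prod_erase _ _ hmn, hC]
    ring

/-- The discounted expectation along the chain, given the first visited states. -/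
theorem IsMinimalChain.lintegral_prod_mul (hc : IsMinimalChain q P J S)
    (hq : IsSingleDeathRate q) (i : ℕ) {f : ℕ → ℝ≥0∞ → ℝ≥0∞} {c : ℕ → ℝ≥0∞}
    (hf : ∀ y, ExpIntegral Ω (exitRate q y) (f y) (c y)) (g : ℕ → ℝ≥0∞) (n : ℕ) :
    ∀ (m : ℕ) (x : ℕ → ℕ),
    ∫⁻ w, (∏ k ∈ Finset.range m, if J k w = x k then f (x k) (S k w) else 0) *
      ((if J m w = x m then 1 else 0) * ((∏ k ∈ Finset.Ico m (m + n), f (J k w) (S k w)) *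
        (g (J (m + n) w) * if 0 < S (m + n) w then 1 else 0))) ∂(P i) =
    pathWeight q i x m * (∏ k ∈ Finset.range m, c (x k)) * stepSum q c g n (x m) := by
  have hgm : Measurable g := measurable_of_countable g
  have hfm : ∀ k, Measurable fun w => f (J k w) (S k w) := fun k => by
    have : Measurable fun z : ℕ × ℝ≥0∞ => f z.1 z.2 :=
      measurable_from_prod_countable_right fun y => (hf y).measurable
    exact this.comp ((hc.measurable_state k).prodMk (hc.measurable_hold k))
  have hpm : ∀ k, Measurable fun w => if 0 < S k w then (1 : ℝ≥0∞) else 0 := fun k =>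
    Measurable.ite (measurableSet_lt measurable_const (hc.measurable_hold k))
      measurable_const measurable_const
  have him : ∀ k y, Measurable fun w => if J k w = y then (1 : ℝ≥0∞) else 0 := fun k y =>
    Measurable.ite (hc.measurable_state k (measurableSet_singleton y))
      measurable_const measurable_const
  induction n with
  | zero =>
    intro m x
    have h := hc.lintegral_prod hq i m x
      (fun k => if k < m then f (x k) else fun s => if 0 < s then 1 else 0)
      (fun k => if k < m then c (x k) else 1) (fun k => by
        by_cases hk : k < m
        · simpa only [hk, if_true] using hf (x k)
        · simpa only [hk, if_false] using expIntegral_pos Ω _)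
    rw [Finset.prod_range_succ, if_neg (lt_irrefl m), mul_one,
      Finset.prod_congr rfl fun k hk => if_pos (Finset.mem_range.mp hk)] at h
    rw [stepSum, ← h, ← lintegral_mul_const]
    · refine lintegral_congr fun w => ?_
      rw [Finset.prod_range_succ, if_neg (lt_irrefl m), add_zero, Finset.Ico_self,
        Finset.prod_empty, one_mul, mul_assoc]
      congr 1
      · refine Finset.prod_congr rfl fun k hk => ?_
        simp only [Finset.mem_range.mp hk, if_true]
      · by_cases hJ : J m w = x m
        · simp only [hJ, if_true, one_mul, mul_comm]
        · simp [hJ]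
    · refine Finset.measurable_prod _ fun k _ => ?_
      refine hc.measurable_factor ?_ k (x k)
      split_ifs
      · exact (hf (x k)).measurable
      · exact (expIntegral_pos Ω 0).measurable
  | succ n ih =>
    intro m x
    -- Summing over the value `y` of `J (m + 1)` extends the prescribed path by one state and moves
    -- the factor at `m` into the prescribed part.
    have hpt : ∀ w, (∏ k ∈ Finset.range m, if J k w = x k then f (x k) (S k w) else 0) *
        ((if J m w = x m then 1 else 0) * ((∏ k ∈ Finset.Ico m (m + (n + 1)), f (J k w) (S k w)) *
          (g (J (m + (n + 1)) w) * if 0 < S (m + (n + 1)) w then 1 else 0))) =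
        ∑' y, (∏ k ∈ Finset.range (m + 1), if J k w = Function.update x (m + 1) y k then
            f (Function.update x (m + 1) y k) (S k w) else 0) *
          ((if J (m + 1) w = Function.update x (m + 1) y (m + 1) then 1 else 0) *
            ((∏ k ∈ Finset.Ico (m + 1) (m + 1 + n), f (J k w) (S k w)) *
            (g (J (m + 1 + n) w) * if 0 < S (m + 1 + n) w then 1 else 0))) := by
      intro w
      have hprod : ∀ y, (∏ k ∈ Finset.range (m + 1), if J k w = Function.update x (m + 1) y k then
            f (Function.update x (m + 1) y k) (S k w) else 0) =
          ∏ k ∈ Finset.range (m + 1), if J k w = x k then f (x k) (S k w) else 0 := fun y =>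
        Finset.prod_congr rfl fun k hk => by
          rw [Function.update_of_ne (Finset.mem_range.mp hk).ne]
      simp_rw [hprod, Function.update_self]
      rw [ENNReal.tsum_mul_left, ENNReal.tsum_mul_right, tsum_eq_single (J (m + 1) w)
        (fun y hy => if_neg hy.symm), if_pos rfl, one_mul, Finset.prod_range_succ,
        Finset.prod_eq_prod_Ico_succ_bot (by omega), show m + (n + 1) = m + 1 + n by omega]
      by_cases hJ : J m w = x m
      · simp only [hJ, if_true]; ring
      · simp [hJ]
    simp_rw [hpt]
    rw [lintegral_tsum]
    swap
    · intro y
      refine Measurable.aemeasurable ?_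
      exact (Finset.measurable_prod _ fun k _ => hc.measurable_factor (hf _).measurable k _).mul
        ((him _ _).mul ((Finset.measurable_prod _ fun k _ => hfm k).mul
          ((hgm.comp (hc.measurable_state _)).mul (hpm _))))
    simp_rw [ih (m + 1)]
    rw [stepSum, ← mul_assoc, ← ENNReal.tsum_mul_left]
    refine tsum_congr fun y => ?_
    rw [Function.update_self, Finset.prod_congr rfl fun k hk => show
      c (Function.update x (m + 1) y k) = c (x k) by
        rw [Function.update_of_ne (Finset.mem_range.mp hk).ne], Finset.prod_range_succ]
    have hw : pathWeight q i (Function.update x (m + 1) y) (m + 1) =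
        pathWeight q i x m * ENNReal.ofReal (jumpProb q (x m) y) := by
      rw [pathWeight, pathWeight, Finset.prod_range_succ, Function.update_self,
        Function.update_of_ne (by omega), Function.update_of_ne (by omega), mul_assoc]
      congr 2
      refine Finset.prod_congr rfl fun k hk => ?_
      have := Finset.mem_range.mp hk
      rw [Function.update_of_ne (by omega), Function.update_of_ne (by omega)]
    rw [hw]
    ring

theorem IsMinimalChain.lintegral_stepSum (hc : IsMinimalChain q P J S)
    (hq : IsSingleDeathRate q) (i : ℕ) {f : ℕ → ℝ≥0∞ → ℝ≥0∞} {c : ℕ → ℝ≥0∞}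
    (hf : ∀ y, ExpIntegral Ω (exitRate q y) (f y) (c y)) (g : ℕ → ℝ≥0∞) (n : ℕ) :
    ∫⁻ w, (if J 0 w = i then 1 else 0) * ((∏ k ∈ Finset.range n, f (J k w) (S k w)) *
        (g (J n w) * if 0 < S n w then 1 else 0)) ∂(P i) = stepSum q c g n i := by
  simpa [pathWeight] using hc.lintegral_prod_mul hq i hf g n 0 fun _ => i

theorem stepSum_one (hq : IsSingleDeathRate q) (n : ℕ) :
    ∀ i, stepSum q (fun _ => 1) (fun _ => 1) n i = 1 := by
  induction n with
  | zero => exact fun i => rfl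
  | succ n ih =>
    intro i
    rw [stepSum]
    simp_rw [ih]
    simp [tsum_ofReal_jumpProb hq]

/-- With all discounts equal to `1` the expectation is the total mass `1` of the jump chain, so the
event has full probability. -/
theorem IsMinimalChain.ae_start_and_pos (hc : IsMinimalChain q P J S) (hq : IsSingleDeathRate q)
    (i : ℕ) : ∀ᵐ w ∂(P i), J 0 w = i ∧ ∀ k, 0 < S k w := by
  have := hc.prob i
  suffices h : ∀ n, ∀ᵐ w ∂(P i), J 0 w = i ∧ 0 < S n w by
    filter_upwards [ae_all_iff.mpr h] with w hw using ⟨(hw 0).1, fun k => (hw k).2⟩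
  intro n
  have h := hc.lintegral_stepSum hq i (fun y => expIntegral_pos Ω (exitRate q y)) (fun _ => 1) n
  rw [stepSum_one hq] at h
  have hm : MeasurableSet {w | J 0 w = i ∧ 0 < S n w} :=
    (hc.measurable_state 0 (measurableSet_singleton i)).inter
      (measurableSet_lt measurable_const (hc.measurable_hold n))
  refine (prob_compl_eq_zero_iff hm).mpr (le_antisymm prob_le_one ?_)
  rw [← h, ← lintegral_indicator_one hm]
  refine lintegral_mono fun w => ?_
  have hle : (∏ k ∈ Finset.range n, if 0 < S k w then (1 : ℝ≥0∞) else 0) ≤ 1 :=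
    Finset.prod_le_one' fun k _ => by split_ifs <;> simp
  by_cases h1 : J 0 w = i <;> by_cases h2 : 0 < S n w <;>
    simp only [Set.indicator_apply, Set.mem_ofPred_eq, h1, h2, and_true, and_false, if_true,
      if_false, one_mul, mul_one, mul_zero, zero_mul, Pi.one_apply, le_refl]
  exact hle

theorem IsMinimalChain.ae_jumpProb_ne_zero (hc : IsMinimalChain q P J S)
    (hq : IsSingleDeathRate q) (i : ℕ) :
    ∀ᵐ w ∂(P i), ∀ n, jumpProb q (J n w) (J (n + 1) w) ≠ 0 := by
  refine ae_all_iff.mpr fun n => ?_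
  -- Finite words are used because there are only countably many, so the null events can be united.
  have hnull : ∀ x : Fin (n + 2) → ℕ, ∀ᵐ w ∂(P i),
      jumpProb q (x (Fin.ofNat _ n)) (x (Fin.ofNat _ (n + 1))) = 0 →
      ¬ ∀ k ≤ n + 1, J k w = x (Fin.ofNat _ k) ∧ ((0 : ℝ≥0) : ℝ≥0∞) < S k w := by
    intro x
    by_cases hx : jumpProb q (x (Fin.ofNat _ n)) (x (Fin.ofNat _ (n + 1))) = 0
    · simp only [hx, true_imp_iff]
      refine (measure_eq_zero_iff_ae_notMem (s := {w | ∀ k ≤ n + 1, J k w = x (Fin.ofNat _ k) ∧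
        ((0 : ℝ≥0) : ℝ≥0∞) < S k w})).mp ?_
      rw [hc.law_eq hq i (n + 1) (fun k => x (Fin.ofNat _ k)) fun _ => 0, pathWeight,
        Finset.prod_range_succ, hx]
      simp
    · exact Eventually.of_forall fun w h => absurd h hx
  filter_upwards [ae_all_iff.mpr hnull, hc.ae_start_and_pos hq i] with w hw hpos h0
  have hval : ∀ k ≤ n + 1, (Fin.ofNat (n + 2) k).val = k := fun k hk =>
    Nat.mod_eq_of_lt (by omega)
  refine hw (fun k => J k.val w) ?_ fun k hk => ⟨?_, by simpa using hpos.2 k⟩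
  · rw [hval n (by omega), hval (n + 1) le_rfl]
    exact h0
  · rw [hval k hk]

end chain

/-! ### Hitting times and additive functionals of a path -/

theorem jumpTime_succ (s : ℕ → ℝ≥0∞) (n : ℕ) : jumpTime s (n + 1) = jumpTime s n + s n :=
  Finset.sum_range_succ _ _

theorem jumpTime_mono (s : ℕ → ℝ≥0∞) : Monotone (jumpTime s) :=
  monotone_nat_of_le_succ fun n => by rw [jumpTime_succ]; exact le_self_add

theorem jumpTime_index_unique {s : ℕ → ℝ≥0∞} {t : ℝ≥0∞} {k l : ℕ} (hk : jumpTime s k ≤ t)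
    (hk' : t < jumpTime s (k + 1)) (hl : jumpTime s l ≤ t) (hl' : t < jumpTime s (l + 1)) :
    k = l := by
  rcases lt_trichotomy k l with h | h | h
  · exact absurd (hk'.trans_le ((jumpTime_mono s h).trans hl)) (lt_irrefl _)
  · exact h
  · exact absurd (hl'.trans_le ((jumpTime_mono s h).trans hk)) (lt_irrefl _)

theorem path_eq {x : ℕ → ℕ} {s : ℕ → ℝ≥0∞} {t : ℝ≥0} {k : ℕ} (hk : jumpTime s k ≤ t)
    (hk' : (t : ℝ≥0∞) < jumpTime s (k + 1)) : path x s t = some (x k) := by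
  classical
  have h : ∃ n, jumpTime s n ≤ (t : ℝ≥0∞) ∧ (t : ℝ≥0∞) < jumpTime s (n + 1) := ⟨k, hk, hk'⟩
  rw [path, dif_pos h]
  obtain ⟨h1, h2⟩ := Nat.find_spec h
  rw [jumpTime_index_unique hk hk' h1 h2]

theorem exists_of_path_eq {x : ℕ → ℕ} {s : ℕ → ℝ≥0∞} {t : ℝ≥0} {a : ℕ}
    (h : path x s t = some a) :
    ∃ k, jumpTime s k ≤ t ∧ (t : ℝ≥0∞) < jumpTime s (k + 1) ∧ x k = a := by
  classical
  rw [path] at h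
  split_ifs at h with hex
  exact ⟨Nat.find hex, (Nat.find_spec hex).1, (Nat.find_spec hex).2, Option.some_inj.mp h⟩

section path

variable {Ω : Type*} {J : ℕ → Ω → ℕ} {S : ℕ → Ω → ℝ≥0∞}

theorem exists_of_hittingTime_lt_top {a : ℕ} {w : Ω}
    (h : hittingTime (process J S) a w < ⊤) :
    ∃ k, J k w = a ∧ jumpTime (fun n => S n w) k < ⊤ := by
  obtain ⟨_, ⟨t, ht, rfl⟩, -⟩ := sInf_lt_iff.mp h
  obtain ⟨k, h1, -, h3⟩ := exists_of_path_eq ht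
  exact ⟨k, h3, h1.trans_lt ENNReal.coe_lt_top⟩

/-- Positivity of `S n` makes the `n`-th visit a non-empty time interval, so `a` is really occupied
at the `n`-th jump time. -/
theorem hittingTime_eq {a n : ℕ} {w : Ω} (hn : J n w = a) (hlt : ∀ k < n, a < J k w)
    (hfin : jumpTime (fun k => S k w) n < ⊤) (hpos : 0 < S n w) :
    hittingTime (process J S) a w = jumpTime (fun k => S k w) n := by
  refine le_antisymm (sInf_le ⟨(jumpTime (fun k => S k w) n).toNNReal, ?_,
    ENNReal.coe_toNNReal hfin.ne⟩) (le_sInf ?_)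
  · have hc := ENNReal.coe_toNNReal hfin.ne
    rw [← hn]
    refine path_eq (x := fun k => J k w) hc.ge ?_
    rw [hc, jumpTime_succ]
    exact ENNReal.lt_add_right hfin.ne hpos.ne'
  · rintro _ ⟨t, ht, rfl⟩
    obtain ⟨k, h1, -, h3⟩ := exists_of_path_eq ht
    refine le_trans (jumpTime_mono _ ?_) h1
    by_contra! hk
    exact absurd h3 (hlt k hk).ne'

theorem lintegral_process (ω : ℕ → ℝ) (w : Ω) (n : ℕ)
    (hfin : jumpTime (fun k => S k w) n < ⊤) :
    ∫⁻ t in {t : ℝ | 0 ≤ t ∧ ENNReal.ofReal t < jumpTime (fun k => S k w) n},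
      ENNReal.ofReal (extend ω (process J S t.toNNReal w)) =
    ∑ k ∈ Finset.range n, ENNReal.ofReal (ω (J k w)) * S k w := by
  induction n with
  | zero =>
    simp [jumpTime]
  | succ n ih =>
    set T := jumpTime (fun k => S k w) with hT
    have hle : T n ≤ T (n + 1) := jumpTime_mono _ (Nat.le_succ n)
    have hfin' : T n < ⊤ := hle.trans_lt hfin
    have hsplit : {t : ℝ | 0 ≤ t ∧ ENNReal.ofReal t < T (n + 1)} =
        {t : ℝ | 0 ≤ t ∧ ENNReal.ofReal t < T n} ∪ Set.Ico (T n).toReal (T (n + 1)).toReal := by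
      ext t
      simp only [Set.mem_ofPred_eq, Set.mem_union, Set.mem_Ico]
      constructor
      · rintro ⟨h0, h1⟩
        rcases lt_or_ge (ENNReal.ofReal t) (T n) with h | h
        · exact Or.inl ⟨h0, h⟩
        · exact Or.inr ⟨ENNReal.toReal_le_of_le_ofReal h0 h,
            (ENNReal.ofReal_lt_iff_lt_toReal h0 hfin.ne).mp h1⟩
      · rintro (⟨h0, h1⟩ | ⟨h0, h1⟩)
        · exact ⟨h0, h1.trans_le hle⟩
        · have h0' : 0 ≤ t := ENNReal.toReal_nonneg.trans h0
          exact ⟨h0', (ENNReal.ofReal_lt_iff_lt_toReal h0' hfin.ne).mpr h1⟩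
    have hdisj : Disjoint {t : ℝ | 0 ≤ t ∧ ENNReal.ofReal t < T n}
        (Set.Ico (T n).toReal (T (n + 1)).toReal) := by
      rw [Set.disjoint_left]
      rintro t ⟨h0, h1⟩ ⟨h2, -⟩
      exact absurd ((ENNReal.ofReal_lt_iff_lt_toReal h0 hfin'.ne).mp h1) (not_lt.mpr h2)
    rw [hsplit, lintegral_union measurableSet_Ico hdisj, ih hfin', Finset.sum_range_succ]
    congr 1
    have hval : ∀ t ∈ Set.Ico (T n).toReal (T (n + 1)).toReal,
        ENNReal.ofReal (extend ω (process J S t.toNNReal w)) = ENNReal.ofReal (ω (J n w)) := by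
      rintro t ⟨h0, h1⟩
      have h0' : 0 ≤ t := ENNReal.toReal_nonneg.trans h0
      have : process J S t.toNNReal w = some (J n w) :=
        path_eq (x := fun k => J k w) (s := fun k => S k w)
          ((ENNReal.le_ofReal_iff_toReal_le hfin'.ne h0').mpr h0)
          ((ENNReal.ofReal_lt_iff_lt_toReal h0' hfin.ne).mpr h1)
      rw [this]
      rfl
    rw [setLIntegral_congr_fun measurableSet_Ico hval, setLIntegral_const, Real.volume_Ico,
      ENNReal.ofReal_sub _ ENNReal.toReal_nonneg, ENNReal.ofReal_toReal hfin.ne,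
      ENNReal.ofReal_toReal hfin'.ne]
    congr 1
    rw [hT, jumpTime_succ]
    exact ENNReal.add_sub_cancel_left hfin'.ne

/-- `e^{-ω s}` on positive holding times `s` in states above `a`, and `0` elsewhere. -/
def killFactor (ω : ℕ → ℝ) (a y : ℕ) (s : ℝ≥0∞) : ℝ≥0∞ :=
  if a < y then (if 0 < s then ENNReal.ofReal (expNeg (ENNReal.ofReal (ω y) * s)) else 0) else 0

/-- Only `m = n` contributes: for `m < n` the state is above `a`, and for `m > n` the product
contains the vanishing kill factor of the visit to `a`. -/
theorem ofReal_expNeg_additive {ω : ℕ → ℝ} {a n : ℕ} {w : Ω} (hn : J n w = a)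
    (hlt : ∀ k < n, a < J k w) (hfin : jumpTime (fun k => S k w) n < ⊤)
    (hpos : ∀ k, 0 < S k w) :
    ENNReal.ofReal (expNeg (additive (process J S) ω a w)) =
      ∑' m, (∏ k ∈ Finset.range m, killFactor ω a (J k w) (S k w)) *
        ((if J m w = a then 1 else 0) * if 0 < S m w then 1 else 0) := by
  rw [tsum_eq_single n]
  · rw [if_pos hn, if_pos (hpos n), mul_one, mul_one, additive,
      hittingTime_eq hn hlt hfin (hpos n), lintegral_process ω w n hfin, expNeg_sum,
      ENNReal.ofReal_prod_of_nonneg fun k _ => expNeg_nonneg _]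
    refine Finset.prod_congr rfl fun k hk => ?_
    rw [killFactor, if_pos (hlt k (Finset.mem_range.mp hk)), if_pos (hpos k)]
  · intro m hm
    rcases lt_or_gt_of_ne hm with h | h
    · rw [if_neg (hlt m h).ne', zero_mul, mul_zero]
    · rw [Finset.prod_eq_zero (Finset.mem_range.mpr h), zero_mul]
      rw [killFactor, hn, if_neg (lt_irrefl a)]

theorem additive_zero (Y : ℝ≥0 → Ω → Option ℕ) (a : ℕ) (w : Ω) : additive Y 0 a w = 0 := by
  have : ∀ y : Option ℕ, extend 0 y = 0 := fun y => by cases y <;> rfl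
  simp [additive, this]

end path

/-- Downward steps have size at most one, so the first entrance into `[0, a]` is at `a` itself. -/
theorem exists_first_passage {x : ℕ → ℕ} {a m : ℕ} (h0 : a < x 0) (hm : x m = 0)
    (hstep : ∀ n, x n ≤ x (n + 1) + 1) : ∃ n ≤ m, x n = a ∧ ∀ k < n, a < x k := by
  have hex : ∃ n, x n ≤ a := ⟨m, by omega⟩
  classical
  have hmin : ∀ k < Nat.find hex, a < x k := fun k hk => not_le.mp (Nat.find_min hex hk)
  refine ⟨Nat.find hex, Nat.find_min' hex (by omega), le_antisymm (Nat.find_spec hex) ?_, hmin⟩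
  obtain ⟨k, hk⟩ : ∃ k, Nat.find hex = k + 1 := Nat.exists_eq_succ_of_ne_zero fun h => by
    have := Nat.find_spec hex
    rw [h] at this
    omega
  have h1 := hmin k (by omega)
  have h2 := hstep k
  rw [hk]
  omega

/-! ### The Laplace functional of the hitting time -/

section chain

variable {q : ℕ → ℕ → ℝ} {Ω : Type*} [MeasurableSpace Ω] {P : ℕ → Measure Ω} {J : ℕ → Ω → ℕ}
  {S : ℕ → Ω → ℝ≥0∞}

theorem expIntegral_killFactor (Ω : Type*) [MeasurableSpace Ω] (hq : IsSingleDeathRate q)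
    {ω : ℕ → ℝ} (hω : ∀ i, 1 ≤ i → 0 ≤ ω i) (a y : ℕ) :
    ExpIntegral Ω (exitRate q y) (killFactor ω a y) (discount q ω a y) := by
  by_cases h : a < y
  · have := expIntegral_expNeg Ω (exitRate_pos hq (show 1 ≤ y by omega)) (hω y (by omega))
    rw [discount, if_pos h]
    convert this using 1
    ext s
    rw [killFactor, if_pos h]
  · rw [discount, if_neg h]
    convert expIntegral_zero Ω (exitRate q y) using 1
    ext s
    rw [killFactor, if_neg h]

/-- The Laplace functional of the chain up to the hitting time of a lower state, in terms of the
discounted jump chain. -/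
theorem IsMinimalChain.integral_expNeg_additive (hc : IsMinimalChain q P J S)
    (hq : IsSingleDeathRate q) {ω : ℕ → ℝ} (hω : ∀ i, 1 ≤ i → 0 ≤ ω i) {a i : ℕ} (h : a < i)
    (hhit : ∀ᵐ w ∂(P i), hittingTime (process J S) 0 w < ⊤) :
    ∫ w, expNeg (additive (process J S) ω a w) ∂(P i) = (hitSum q ω a i).toReal := by
  set F : ℕ → Ω → ℝ≥0∞ := fun n w => (if J 0 w = i then 1 else 0) *
    ((∏ k ∈ Finset.range n, killFactor ω a (J k w) (S k w)) *
      ((if J n w = a then 1 else 0) * if 0 < S n w then 1 else 0)) with hF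
  have hkm : ∀ k, Measurable fun w => killFactor ω a (J k w) (S k w) := fun k => by
    have : Measurable fun z : ℕ × ℝ≥0∞ => killFactor ω a z.1 z.2 :=
      measurable_from_prod_countable_right fun y =>
        (expIntegral_killFactor Ω hq hω a y).measurable
    exact this.comp ((hc.measurable_state k).prodMk (hc.measurable_hold k))
  have him : ∀ k y, Measurable fun w => if J k w = y then (1 : ℝ≥0∞) else 0 := fun k y =>
    Measurable.ite (hc.measurable_state k (measurableSet_singleton y))
      measurable_const measurable_const
  have hFm : ∀ n, Measurable (F n) := fun n =>
    (him 0 i).mul ((Finset.measurable_prod _ fun k _ => hkm k).mul ((him n a).mul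
      (Measurable.ite (measurableSet_lt measurable_const (hc.measurable_hold n))
        measurable_const measurable_const)))
  have hae : ∀ᵐ w ∂(P i),
      ENNReal.ofReal (expNeg (additive (process J S) ω a w)) = ∑' n, F n w := by
    filter_upwards [hhit, hc.ae_start_and_pos hq i, hc.ae_jumpProb_ne_zero hq i]
      with w hw ⟨hw0, hpos⟩ hjump
    -- The state `0` is reached after finite time, and the first passage through `a` comes no later;
    -- this makes its jump time finite.
    obtain ⟨m, hm, hmfin⟩ := exists_of_hittingTime_lt_top hw
    obtain ⟨n, hnm, hn, hlt⟩ := exists_first_passage (x := fun k => J k w) (a := a) (m := m)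
      (by simpa only [hw0] using h) hm (fun k => by
        by_contra! hk
        exact hjump k (jumpProb_eq_zero hq (by omega)))
    rw [ofReal_expNeg_additive hn hlt ((jumpTime_mono _ hnm).trans_lt hmfin) hpos]
    simp only [hF, hw0, if_true, one_mul]
  have hint : ∫⁻ w, ∑' n, F n w ∂(P i) = hitSum q ω a i := by
    rw [lintegral_tsum fun n => (hFm n).aemeasurable, hitSum]
    exact tsum_congr fun n => hc.lintegral_stepSum hq i (expIntegral_killFactor Ω hq hω a)
      (fun j => if j = a then 1 else 0) n
  rw [← hint, ← integral_toReal (Measurable.tsum hFm).aemeasurable]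
  · refine integral_congr_ae ?_
    filter_upwards [hae] with w hw
    rw [← hw, ENNReal.toReal_ofReal (expNeg_nonneg _)]
  · filter_upwards [hae] with w hw
    rw [← hw]
    exact ENNReal.ofReal_lt_top

/-- For `ω = 0` the Laplace functional is the integral of `1`. -/
theorem IsMinimalChain.hitSum_zero_eq_one (hc : IsMinimalChain q P J S)
    (hq : IsSingleDeathRate q) {a i : ℕ} (h : a < i)
    (hhit : ∀ᵐ w ∂(P i), hittingTime (process J S) 0 w < ⊤) : hitSum q 0 a i = 1 := by
  have := hc.prob i
  have h1 := hc.integral_expNeg_additive hq (ω := 0) (fun _ _ => le_rfl) h hhit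
  simp only [additive_zero, expNeg_zero, integral_const, probReal_univ, smul_eq_mul,
    mul_one] at h1
  exact (ENNReal.toReal_eq_one_iff _).mp h1.symm

end chain

end SingleDeath

end

/-! ### The main theorem -/

theorem mainTheorem6 {Ω : Type*} [MeasurableSpace Ω]
    (q : ℕ → ℕ → ℝ) (hq : SingleDeath.IsSingleDeathRate q)
    (P : ℕ → Measure Ω) (J : ℕ → Ω → ℕ) (S : ℕ → Ω → ℝ≥0∞)
    (hchain : SingleDeath.IsMinimalChain q P J S)
    (Y : ℝ≥0 → Ω → Option ℕ) (hY : Y = SingleDeath.process J S)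
    (ω : ℕ → ℝ) (hω : ∀ i, 1 ≤ i → 0 ≤ ω i)
    (hhit : ∀ i, 1 ≤ i → ∀ᵐ w ∂(P i), SingleDeath.hittingTime Y 0 w < ⊤) :
    (∀ a i : ℕ, a < i →
      Tendsto (fun N => SingleDeath.W q ω i N / SingleDeath.W q ω a N) atTop
        (𝓝 (∫ w, SingleDeath.expNeg (SingleDeath.additive Y ω a w) ∂(P i))) ∧
      Tendsto (fun N => SingleDeath.Z q ω i N / SingleDeath.Z q ω a N) atTop
        (𝓝 (∫ w, SingleDeath.expNeg (SingleDeath.additive Y ω a w) ∂(P i)))) ∧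
    (Summable (fun u => ω (u + 1) * SingleDeath.W q 0 0 (u + 1)) →
      (∀ i : ℕ, Summable (fun u => ω (i + 1 + u) * SingleDeath.W q ω i (i + 1 + u))) ∧
      (∀ a i : ℕ, a < i →
        ∫ w, SingleDeath.expNeg (SingleDeath.additive Y ω a w) ∂(P i) =
          SingleDeath.ZInf q ω i / SingleDeath.ZInf q ω a)) := by
  subst hY
  have hlim : ∀ a i : ℕ, a < i →
      Tendsto (fun N => SingleDeath.W q ω i N / SingleDeath.W q ω a N) atTop
        (𝓝 (∫ w, SingleDeath.expNeg
          (SingleDeath.additive (SingleDeath.process J S) ω a w) ∂(P i))) ∧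
      Tendsto (fun N => SingleDeath.Z q ω i N / SingleDeath.Z q ω a N) atTop
        (𝓝 (∫ w, SingleDeath.expNeg
          (SingleDeath.additive (SingleDeath.process J S) ω a w) ∂(P i))) := by
    intro a i h
    rw [hchain.integral_expNeg_additive hq hω h (hhit i (by omega))]
    exact ⟨SingleDeath.tendsto_W_ratio hq hω h.le, SingleDeath.tendsto_Z_ratio hq hω h.le
      (hchain.hitSum_zero_eq_one hq h (hhit i (by omega)))⟩
  refine ⟨hlim, fun hs => ?_⟩
  have hsum := SingleDeath.summable_weight_mul_W hq hω hs
  refine ⟨fun i => ?_, fun a i h => ?_⟩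
  · exact (hsum i).comp_injective (add_right_injective (i + 1))
  · refine tendsto_nhds_unique (hlim a i h).2
      ((SingleDeath.tendsto_Z_ZInf (hsum i)).div (SingleDeath.tendsto_Z_ZInf (hsum a)) ?_)
    -- The limit of the denominator is at least `1`, hence non-zero.
    rw [SingleDeath.ZInf_eq (hsum a)]
    have : 0 ≤ ∑' u, ω u * SingleDeath.W q ω a u :=
      tsum_nonneg (SingleDeath.weight_mul_W_nonneg hq hω a)
    linarith
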